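/- All algebras are over $\mathbb{C}$. A derivation of a Lie algebra $L$ is a linear map $D:L\to L$ with $D([x,y])=[D(x),y]+[x,D(y)]$ for all $x,y\in L$. A map $\Delta:L\to L$ (not assumed linear) is a 2-local derivation if for every $x,y\in L$ there is a derivation $D_{x,y}$ of $L$ with $\Delta(x)=D_{x,y}(x)$ and $\Delta(y)=D_{x,y}(y)$. For $n\in\{1,2,3,\dots\}$ let $W_n^+=\mathrm{Der}(\mathbb{C}[t_1,\dots,t_n])$, the Lie algebra, under the commutator, of all derivations of the polynomial algebra. Let $W_\infty^+$ be the Lie algebra of those derivations of $\mathbb{C}[t_1,t_2,\dots]$ that are finite linear combinations of the operators $t^\alpha\frac{\partial}{\partial t_i}$, where $i\ge 1$ and $\alpha$ runs over the finitely supported sequences of non-negative integers. For $n\in\{1,2,3,\dots\}\cup\{\infty\}$ put $d_i=t_i\frac{\partial}{\partial t_i}$, let $\mathfrak{h}_n$ be the linear span of the $d_i$ ($1\le i\le n$, respectively $i\ge 1$ if $n=\infty$), and let $$W_n^{++}=\sum_{\alpha\in\mathbb{Z}_+^n}t^\alpha\,\mathfrak{h}_n ,$$ a Lie subalgebra of $W_n^+$,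 where $\mathbb{Z}_+^n$ is the set of $n$-tuples of non-negative integers and $\mathbb{Z}_+^\infty$ the set of finitely supported sequences of them (all sums are finite). **Theorem.** Let $n\in\{1,2,3,\dots\}\cup\{\infty\}$. Then every 2-local derivation on $W_n^+$ is a derivation of $W_n^+$, and every 2-local derivation on $W_n^{++}$ is a derivation of $W_n^{++}$. -/

import Mathlib

open MvPolynomial

/-- `Δ : L → L`, not assumed linear, is a 2-local derivation of the Lie algebra `L` over `R`:
on any two elements it agrees with some derivation of `L` (depending on the two elements). -/
def IsTwoLocalDerivation (R : Type*) {L : Type*} [CommRing R] [LieRing L] [LieAlgebra R L]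
    (Δ : L → L) : Prop :=
  ∀ x y : L, ∃ D : LieDerivation R L L, Δ x = D x ∧ Δ y = D y

/-- The map `Δ : L → L` is a derivation of the Lie algebra `L` over `R`. -/
def IsLieDerivationMap (R : Type*) {L : Type*} [CommRing R] [LieRing L] [LieAlgebra R L]
    (Δ : L → L) : Prop :=
  ∃ D : LieDerivation R L L, ∀ x : L, Δ x = D x

/-- `Der(ℂ[t_i : i ∈ σ])`, the Lie algebra (under the commutator) of all `ℂ`-linear derivations of
the polynomial algebra in the variables `t_i = X i`. -/
abbrev PolyDer (σ : Type) : Type :=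
  Derivation ℂ (MvPolynomial σ ℂ) (MvPolynomial σ ℂ)

/-- The operator `t^α ∂/∂t_i`. -/
noncomputable def partialTerm {σ : Type} (α : σ →₀ ℕ) (i : σ) : PolyDer σ :=
  (monomial α (1 : ℂ)) • (pderiv i : PolyDer σ)

/-- The operator `t^α d_i`, where `d_i = t_i ∂/∂t_i`. -/
noncomputable def eulerTerm {σ : Type} (α : σ →₀ ℕ) (i : σ) : PolyDer σ :=
  (monomial α (1 : ℂ)) • ((X i : MvPolynomial σ ℂ) • (pderiv i : PolyDer σ))

theorem lie_partialTerm {σ : Type} (α β : σ →₀ ℕ) (i j : σ) :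
    ⁅partialTerm α i, partialTerm β j⁆ =
      (β i : ℂ) • partialTerm (α + (β - Finsupp.single i 1)) j -
        (α j : ℂ) • partialTerm (β + (α - Finsupp.single j 1)) i := by
  classical
  refine MvPolynomial.derivation_ext fun k => ?_
  simp only [partialTerm, Derivation.commutator_apply, Derivation.smul_apply, Derivation.sub_apply,
    pderiv_X, smul_eq_mul]
  by_cases hj : k = j <;> by_cases hi : k = i <;>
    simp [hj, hi, Pi.single_apply, pderiv_monomial, monomial_mul, smul_monomial] <;>
    simp_all [pderiv_monomial, monomial_mul]

/-- `[t^α d_i, t^β d_j] = β_i t^{α+β} d_j - α_j t^{α+β} d_i`. -/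
theorem lie_eulerTerm {σ : Type} (α β : σ →₀ ℕ) (i j : σ) :
    ⁅eulerTerm α i, eulerTerm β j⁆ =
      (β i : ℂ) • eulerTerm (α + β) j - (α j : ℂ) • eulerTerm (α + β) i := by
  classical
  have key : ∀ γ : σ →₀ ℕ, ∀ l : σ,
      (X l : MvPolynomial σ ℂ) * pderiv l (monomial γ 1) = (γ l : ℂ) • monomial γ 1 := by
    intro γ l
    rw [mul_comm, pderiv_monomial, X, monomial_mul, smul_monomial]
    by_cases h : γ l = 0
    · simp [h]
    · rw [tsub_add_cancel_of_le (Finsupp.single_le_iff.2 (Nat.one_le_iff_ne_zero.2 h))]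
      simp
  have hm : (monomial (α + β) (1 : ℂ) : MvPolynomial σ ℂ) = monomial α 1 * monomial β 1 := by
    rw [monomial_mul, one_mul]
  refine MvPolynomial.derivation_ext fun k => ?_
  have h1 := key β i
  have h2 := key α j
  simp only [Algebra.smul_def] at h1 h2
  simp only [eulerTerm, Derivation.commutator_apply, Derivation.smul_apply, Derivation.sub_apply,
    pderiv_X, smul_eq_mul, Derivation.leibniz, hm, Algebra.smul_def]
  rcases eq_or_ne i j with rfl | hij
  · by_cases hk : k = i
    · subst hk
      simp only [Pi.single_eq_same, Derivation.map_one_eq_zero]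
      linear_combination X k * monomial α 1 * h1 - X k * monomial β 1 * h2
    · simp [hk]
  · by_cases hj : k = j
    · subst hj
      simp only [Pi.single_eq_same, Derivation.map_one_eq_zero, Pi.single_eq_of_ne hij,
        Pi.single_eq_of_ne hij.symm, map_zero]
      linear_combination X k * monomial α 1 * h1
    · by_cases hi : k = i
      · subst hi
        simp only [Pi.single_eq_same, Derivation.map_one_eq_zero, Pi.single_eq_of_ne hij,
          Pi.single_eq_of_ne hij.symm, map_zero]
        linear_combination -X k * monomial β 1 * h2
      · simp [Pi.single_apply, hi, hj]

theorem lie_mem_span_of_generators {L : Type*} [LieRing L] [LieAlgebra ℂ L] {S : Set L}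
    (hS : ∀ x ∈ S, ∀ y ∈ S, ⁅x, y⁆ ∈ Submodule.span ℂ S) {x y : L}
    (hx : x ∈ Submodule.span ℂ S) (hy : y ∈ Submodule.span ℂ S) :
    ⁅x, y⁆ ∈ Submodule.span ℂ S := by
  induction hx, hy using Submodule.span_induction₂ with
  | mem_mem x y hx hy => exact hS x hx y hy
  | zero_left y hy => simp
  | zero_right x hx => simp
  | add_left x y z _ _ _ h1 h2 => rw [add_lie]; exact add_mem h1 h2
  | add_right x y z _ _ _ h1 h2 => rw [lie_add]; exact add_mem h1 h2
  | smul_left r x y _ _ h => rw [smul_lie]; exact Submodule.smul_mem _ r h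
  | smul_right r x y _ _ h => rw [lie_smul]; exact Submodule.smul_mem _ r h

/-- `W^+` in the variables `t_i`, `i ∈ σ`: the finite linear combinations of the operators
`t^α ∂/∂t_i`. For finite `σ` these are all derivations of `ℂ[t_i : i ∈ σ]`
(`wittPlus_eq_top`). For infinite `σ` only finite sums are taken. -/
noncomputable def wittPlus (σ : Type) : LieSubalgebra ℂ (PolyDer σ) where
  toSubmodule := Submodule.span ℂ {x | ∃ (α : σ →₀ ℕ) (i : σ), x = partialTerm α i}
  lie_mem' := by
    intro x y hx hy
    refine lie_mem_span_of_generators ?_ hx hy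
    rintro _ ⟨α, i, rfl⟩ _ ⟨β, j, rfl⟩
    rw [lie_partialTerm]
    exact sub_mem (Submodule.smul_mem _ _ (Submodule.subset_span ⟨_, _, rfl⟩))
      (Submodule.smul_mem _ _ (Submodule.subset_span ⟨_, _, rfl⟩))

/-- `W^{++} = ∑_α t^α 𝔥` in the variables `t_i`, `i ∈ σ`, where `𝔥` is spanned by the
`d_i = t_i ∂/∂t_i`: the finite linear combinations of the operators `t^α d_i`. -/
noncomputable def wittPlusPlus (σ : Type) : LieSubalgebra ℂ (PolyDer σ) where
  toSubmodule := Submodule.span ℂ {x | ∃ (α : σ →₀ ℕ) (i : σ), x = eulerTerm α i}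
  lie_mem' := by
    intro x y hx hy
    refine lie_mem_span_of_generators ?_ hx hy
    rintro _ ⟨α, i, rfl⟩ _ ⟨β, j, rfl⟩
    rw [lie_eulerTerm]
    exact sub_mem (Submodule.smul_mem _ _ (Submodule.subset_span ⟨_, _, rfl⟩))
      (Submodule.smul_mem _ _ (Submodule.subset_span ⟨_, _, rfl⟩))

theorem wittPlus_eq_top (σ : Type) [Finite σ] : wittPlus σ = ⊤ := by
  classical
  have := Fintype.ofFinite σ
  have hmem : ∀ (i : σ) (f : MvPolynomial σ ℂ),
      f • (pderiv i : PolyDer σ) ∈ (wittPlus σ).toSubmodule := by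
    intro i f
    induction f using MvPolynomial.induction_on' with
    | monomial α c =>
      have h : (monomial α c : MvPolynomial σ ℂ) • (pderiv i : PolyDer σ) = c • partialTerm α i := by
        rw [partialTerm, ← smul_assoc, smul_monomial, smul_eq_mul, mul_one]
      rw [h]
      exact Submodule.smul_mem _ _ (Submodule.subset_span ⟨α, i, rfl⟩)
    | add p q hp hq => rw [add_smul]; exact add_mem hp hq
  refine eq_top_iff.2 fun D _ => ?_
  have hD : D = ∑ i, D (X i) • (pderiv i : PolyDer σ) := by
    refine MvPolynomial.derivation_ext fun k => ?_
    rw [← Derivation.coeFnAddMonoidHom_apply (∑ i, D (X i) • (pderiv i : PolyDer σ)), map_sum,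
      Finset.sum_apply]
    simp [Derivation.coeFnAddMonoidHom_apply, pderiv_X, Pi.single_apply]
  rw [hD]
  exact (wittPlus σ).toSubmodule.sum_mem fun i _ => hmem i _

theorem wittPlusPlus_le_wittPlus (σ : Type) : wittPlusPlus σ ≤ wittPlus σ := by
  intro x hx
  refine (Submodule.span_le.2 ?_ : Submodule.span ℂ _ ≤ (wittPlus σ).toSubmodule) hx
  rintro _ ⟨α, i, rfl⟩
  refine Submodule.subset_span ⟨α + Finsupp.single i 1, i, ?_⟩
  rw [eulerTerm, partialTerm, smul_smul, X, monomial_mul, one_mul]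

/-! All the algebras are treated at once: `L` is spanned by certain `t^α ∂_i`, is a module over the
polynomials, and contains every `t^α ∂_i` with `t_i ∣ t^α`. It suffices to find, for each finite set
`S` of variables, one derivation agreeing with `Δ` on the fields living in `S`: three elements at a
time lie in such a piece, and this gives additivity and the Leibniz rule.

Fix `S` and take `E = ∑ a_i t_i ∂_i`, with positive weights on `S` so independent that a weight
determines the exponents in `S`. Then `ad E` is diagonalizable with real eigenvalues. Let `x = ∑
(t_i + t_i²) E`, `i ∈ S`. After subtracting a derivation that agrees with `Δ` at `E` and `x`, assume
`Δ E = Δ x = 0`; the claim is that `Δ` vanishes on the piece.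

The rigidity statement is `exists_apply_eq_mul_lie`: a derivation killing `z = ∑_{β ∈ B} t^β E`,
where `B` contains the exponents of `x`, acts on the piece as `p · ad z`, with `p` a polynomial of
weight zero, that is, free of the variables in `S`. Modulo an inner derivation `ad u` it kills `E`
and so preserves weights; comparing extreme weights in `[u, z]` forces `u = p z`, and the remaining
derivation kills every `t^β E` with `β ∈ B`, hence the whole piece.

Apply this with `z = x + m^N E`, where `m` is a monomial and `N` is large. Since `Δ` also preserves
weights, `Δ z = 0`, so `Δ y = p [x + m^N E, y]`. The part `p [m^N E, y]` lies in weights too high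
for the other terms and vanishes. Either `p = 0`, or `y` commutes with `m^N E`. The latter for all
large `N` makes `y` of weight zero, while `p [x, y]` then has positive weight; so `Δ y = 0`. -/

section RealWeights

/-! ### Gradings of a Lie algebra by real eigenvalues of `ad e`. -/

variable {M : Type*} [LieRing M] [LieAlgebra ℂ M]

/-- The eigenspace of `ad e` for the real eigenvalue `r`. -/
noncomputable def realWeightSpace (e : M) (r : ℝ) : Submodule ℂ M :=
  Module.End.eigenspace (LieAlgebra.ad ℂ M e) (r : ℂ)

/-- The sum of the eigenspaces of `ad e` for the real eigenvalues in `A`. -/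
noncomputable def weightSpan (e : M) (A : Set ℝ) : Submodule ℂ M :=
  ⨆ r ∈ A, realWeightSpace e r

theorem mem_realWeightSpace {e x : M} {r : ℝ} :
    x ∈ realWeightSpace e r ↔ ⁅e, x⁆ = (r : ℂ) • x := by
  rw [realWeightSpace, Module.End.mem_eigenspace_iff, LieAlgebra.ad_apply]

theorem iSupIndep_realWeightSpace (e : M) : iSupIndep (realWeightSpace e) :=
  (Module.End.eigenspaces_iSupIndep (LieAlgebra.ad ℂ M e)).comp Complex.ofReal_injective

theorem realWeightSpace_le_weightSpan (e : M) {A : Set ℝ} {r : ℝ} (hr : r ∈ A) :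
    realWeightSpace e r ≤ weightSpan e A :=
  le_iSup₂_of_le r hr le_rfl

theorem weightSpan_mono (e : M) {A B : Set ℝ} (h : A ⊆ B) : weightSpan e A ≤ weightSpan e B :=
  biSup_mono h

@[elab_as_elim]
theorem weightSpan_induction {e : M} {A : Set ℝ} {p : M → Prop} {x : M} (hx : x ∈ weightSpan e A)
    (mem : ∀ r ∈ A, ∀ x ∈ realWeightSpace e r, p x) (zero : p 0)
    (add : ∀ x y, p x → p y → p (x + y)) : p x := by
  refine Submodule.iSup_induction _ (motive := p) hx (fun r y hy => ?_) zero add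
  exact Submodule.iSup_induction _ (motive := p) hy (fun hr z hz => mem r hr z hz) zero add

theorem eq_zero_of_mem_weightSpan {e x : M} {A B : Set ℝ} (h : Disjoint A B)
    (hA : x ∈ weightSpan e A) (hB : x ∈ weightSpan e B) : x = 0 := by
  have := (iSupIndep_realWeightSpace e).disjoint_biSup_biSup h
  exact Submodule.disjoint_def.1 this x hA hB

theorem lie_mem_weightSpan {e x y : M} {A B C : Set ℝ} (hx : x ∈ weightSpan e A)
    (hy : y ∈ weightSpan e B) (h : ∀ a ∈ A, ∀ b ∈ B, a + b ∈ C) : ⁅x, y⁆ ∈ weightSpan e C := by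
  refine weightSpan_induction hx (fun a ha x hx => ?_) (by simp)
    fun x x' h h' => by rw [add_lie]; exact add_mem h h'
  refine weightSpan_induction hy (fun b hb y hy => ?_) (by simp)
    fun y y' h h' => by rw [lie_add]; exact add_mem h h'
  refine realWeightSpace_le_weightSpan e (h a ha b hb) ?_
  rw [mem_realWeightSpace] at hx hy ⊢
  rw [leibniz_lie, hx, hy, smul_lie, lie_smul, ← add_smul]
  push_cast
  rfl

theorem exists_split_weightSpan {e x : M} {A : Set ℝ} (hx : x ∈ weightSpan e A) (r : ℝ) :
    ∃ x₀ ∈ realWeightSpace e r, ∃ x' ∈ weightSpan e (A \ {r}), x = x₀ + x' := by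
  refine weightSpan_induction hx (fun a ha x hx => ?_) ?_ ?_
  · by_cases h : a = r
    · exact ⟨x, h ▸ hx, 0, zero_mem _, by simp⟩
    · exact ⟨0, zero_mem _, x, realWeightSpace_le_weightSpan e (by exact ⟨ha, h⟩) hx, by simp⟩
  · exact ⟨0, zero_mem _, 0, zero_mem _, by simp⟩
  · rintro x y ⟨x₀, h₁, x', h₂, rfl⟩ ⟨y₀, h₃, y', h₄, rfl⟩
    exact ⟨x₀ + y₀, add_mem h₁ h₃, x' + y', add_mem h₂ h₄, by abel⟩

theorem exists_finset_weightSpan {e x : M} {A : Set ℝ} (hx : x ∈ weightSpan e A) :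
    ∃ s : Finset ℝ, ↑s ⊆ A ∧ x ∈ weightSpan e (s : Set ℝ) := by
  classical
  refine weightSpan_induction hx (fun a ha x hx => ?_) ?_ ?_
  · exact ⟨{a}, by simpa using ha, realWeightSpace_le_weightSpan e (by simp) hx⟩
  · exact ⟨∅, by simp, zero_mem _⟩
  · rintro x y ⟨s, hs, hx⟩ ⟨t, ht, hy⟩
    refine ⟨s ∪ t, by simp [hs, ht], add_mem ?_ ?_⟩
    · exact weightSpan_mono e (by simp) hx
    · exact weightSpan_mono e (by simp) hy

theorem exists_top_weight {e x : M} {A : Set ℝ} (hx : x ∈ weightSpan e A) (h0 : x ≠ 0) :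
    ∃ r ∈ A, ∃ x₀ ∈ realWeightSpace e r, x₀ ≠ 0 ∧
      ∃ x' ∈ weightSpan e (A ∩ Set.Iio r), x = x₀ + x' := by
  classical
  obtain ⟨s, hs, hx⟩ := exists_finset_weightSpan hx
  induction s using Finset.induction_on_max generalizing x with
  | empty => simp [weightSpan, h0] at hx
  | insert a s hlt ih =>
    obtain ⟨x₀, h₁, x', h₂, rfl⟩ := exists_split_weightSpan hx a
    have hss : ((insert a s : Finset ℝ) : Set ℝ) \ {a} ⊆ s := by
      rintro b ⟨hb, hba⟩
      exact (Finset.mem_insert.1 (Finset.mem_coe.1 hb)).resolve_left hba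
    have hsA : (s : Set ℝ) ⊆ A := fun b hb => hs (by simp [Finset.mem_coe.1 hb])
    have h₂' := weightSpan_mono e hss h₂
    by_cases hz : x₀ = 0
    · subst hz
      simp only [zero_add] at h0 ⊢
      exact ih (weightSpan_mono e hsA h₂') h0 hsA h₂'
    · exact ⟨a, hs (by simp), x₀, h₁, hz, x',
        weightSpan_mono e (fun b hb => Set.mem_inter (hsA hb) (hlt b hb)) h₂', rfl⟩

theorem exists_bot_weight {e x : M} {A : Set ℝ} (hx : x ∈ weightSpan e A) (h0 : x ≠ 0) :
    ∃ r ∈ A, ∃ x₀ ∈ realWeightSpace e r, x₀ ≠ 0 ∧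
      ∃ x' ∈ weightSpan e (A ∩ Set.Ioi r), x = x₀ + x' := by
  classical
  obtain ⟨s, hs, hx⟩ := exists_finset_weightSpan hx
  induction s using Finset.induction_on_min generalizing x with
  | empty => simp [weightSpan, h0] at hx
  | insert a s hlt ih =>
    obtain ⟨x₀, h₁, x', h₂, rfl⟩ := exists_split_weightSpan hx a
    have hss : ((insert a s : Finset ℝ) : Set ℝ) \ {a} ⊆ s := by
      rintro b ⟨hb, hba⟩
      exact (Finset.mem_insert.1 (Finset.mem_coe.1 hb)).resolve_left hba
    have hsA : (s : Set ℝ) ⊆ A := fun b hb => hs (by simp [Finset.mem_coe.1 hb])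
    have h₂' := weightSpan_mono e hss h₂
    by_cases hz : x₀ = 0
    · subst hz
      simp only [zero_add] at h0 ⊢
      exact ih (weightSpan_mono e hsA h₂') h0 hsA h₂'
    · exact ⟨a, hs (by simp), x₀, h₁, hz, x',
        weightSpan_mono e (fun b hb => Set.mem_inter (hsA hb) (hlt b hb)) h₂', rfl⟩

theorem exists_bound_weightSpan {e x : M} {A : Set ℝ} (hx : x ∈ weightSpan e A) :
    ∃ c : ℝ, x ∈ weightSpan e (Set.Icc (-c) c) := by
  obtain ⟨s, -, hx⟩ := exists_finset_weightSpan hx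
  obtain ⟨c, hc⟩ := (s.finite_toSet.image (fun r => |r|)).bddAbove
  exact ⟨c, weightSpan_mono e (fun r hr => abs_le.1 (hc ⟨r, hr, rfl⟩)) hx⟩

theorem exists_lie_eq_of_mem_weightSpan {e x : M} {A : Set ℝ} (hA : (0 : ℝ) ∉ A)
    (hx : x ∈ weightSpan e A) : ∃ y ∈ weightSpan e A, ⁅e, y⁆ = x := by
  refine weightSpan_induction hx (fun r hr x hx => ?_) ⟨0, zero_mem _, by simp⟩ ?_
  · refine ⟨(r : ℂ)⁻¹ • x, Submodule.smul_mem _ _ (realWeightSpace_le_weightSpan e hr hx), ?_⟩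
    have hr0 : (r : ℂ) ≠ 0 := by exact_mod_cast fun h : r = 0 => hA (h ▸ hr)
    rw [lie_smul, mem_realWeightSpace.1 hx, smul_smul, inv_mul_cancel₀ hr0, one_smul]
  · rintro x y ⟨x', h₁, rfl⟩ ⟨y', h₂, rfl⟩
    exact ⟨x' + y', add_mem h₁ h₂, by rw [lie_add]⟩

theorem LieDerivation.mem_realWeightSpace {e x : M} (D : LieDerivation ℂ M M) (hD : D e = 0)
    {r : ℝ} (hx : x ∈ realWeightSpace e r) : D x ∈ realWeightSpace e r := by
  rw [_root_.mem_realWeightSpace] at hx ⊢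
  have := D.apply_lie_eq_add e x
  rw [hx, hD, zero_lie, add_zero, map_smul] at this
  exact this.symm

theorem LieDerivation.mem_weightSpan {e x : M} (D : LieDerivation ℂ M M) (hD : D e = 0)
    {A : Set ℝ} (hx : x ∈ weightSpan e A) : D x ∈ weightSpan e A := by
  refine weightSpan_induction hx (fun r hr x hx => ?_) (by simp)
    fun x y h h' => by rw [map_add]; exact add_mem h h'
  exact realWeightSpace_le_weightSpan e hr (D.mem_realWeightSpace hD hx)

/-- If `ad e` is diagonalizable with real eigenvalues and the centre is trivial, then every
derivation is, up to an inner one, a derivation killing `e`. -/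
theorem exists_lieDerivation_sub_ad_apply_eq_zero {e : M} (htop : weightSpan e Set.univ = ⊤)
    (hcenter : ∀ x : M, (∀ y : M, ⁅x, y⁆ = 0) → x = 0) (D : LieDerivation ℂ M M) :
    ∃ u ∈ weightSpan e {0}ᶜ, (D - LieDerivation.ad ℂ M u) e = 0 := by
  have hall : ∀ x : M, x ∈ weightSpan e Set.univ := fun x => by
    rw [htop]; exact Submodule.mem_top
  obtain ⟨v₀, hv₀, v', hv', hv⟩ := exists_split_weightSpan (hall (D e)) 0
  rw [← Set.compl_eq_univ_sdiff] at hv'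
  obtain ⟨u, hu, rfl⟩ := exists_lie_eq_of_mem_weightSpan (by simp) hv'
  refine ⟨-u, neg_mem hu, ?_⟩
  obtain ⟨D', hD'⟩ : ∃ D', D' = D - LieDerivation.ad ℂ M (-u) := ⟨_, rfl⟩
  rw [← hD']
  have he : D' e = v₀ := by
    rw [hD', LieDerivation.sub_apply, LieDerivation.ad_apply_apply, hv, neg_lie, ← lie_skew e u]
    abel
  rw [he]
  have he0 : e ∈ weightSpan e {0} :=
    realWeightSpace_le_weightSpan e (Set.mem_singleton _) (mem_realWeightSpace.2 (by simp))
  -- Applying `D'` to `[e, y] = r y` gives `[v₀, y] = (r - ad e)(D' y)`. The left side has weight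
  -- `r`, whereas `r - ad e` annihilates the weight-`r` component; hence both sides vanish and `v₀`
  -- is central.
  have hr : ∀ (r : ℝ), ∀ y ∈ realWeightSpace e r, ⁅v₀, y⁆ = 0 := by
    intro r y hy
    obtain ⟨q₀, hq₀, q', hq', hq⟩ := exists_split_weightSpan (hall (D' y)) r
    have h1 := D'.apply_lie_eq_add e y
    rw [mem_realWeightSpace.1 hy, he, map_smul, hq, lie_add, mem_realWeightSpace.1 hq₀,
      smul_add] at h1
    have h2 : ⁅v₀, y⁆ = (r : ℂ) • q' - ⁅e, q'⁆ := by
      rw [eq_sub_iff_add_eq, ← add_right_inj ((r : ℂ) • q₀), h1]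
      abel
    refine eq_zero_of_mem_weightSpan (e := e) (A := {r}) (B := Set.univ \ {r})
      Set.disjoint_sdiff_right ?_ ?_
    · exact lie_mem_weightSpan (realWeightSpace_le_weightSpan e (Set.mem_singleton _) hv₀)
        (realWeightSpace_le_weightSpan e (Set.mem_singleton _) hy) (by simp)
    · rw [h2]
      exact sub_mem (Submodule.smul_mem _ _ hq') (lie_mem_weightSpan he0 hq' (by simp))
  refine hcenter _ fun y => ?_
  refine weightSpan_induction (hall y) (fun r _ y hy => hr r y hy) ?_ ?_
  · simp
  · intro x y h h'
    rw [lie_add, h, h', add_zero]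

end RealWeights

/-! ### Weighted Euler fields, generic weights and commutants of `t^β E`. -/

section EulerField

variable {σ : Type}

/-- The weighted Euler vector field `∑ a_i t_i ∂/∂t_i`. -/
noncomputable def eulerField (a : σ → ℝ) : PolyDer σ :=
  mkDerivation ℂ fun i => (a i : ℂ) • X i

@[simp]
theorem eulerField_X (a : σ → ℝ) (i : σ) : eulerField a (X i) = (a i : ℂ) • X i :=
  mkDerivation_X _ _ _

theorem eulerField_monomial (a : σ → ℝ) (δ : σ →₀ ℕ) (c : ℂ) :
    eulerField a (monomial δ c) = ((Finsupp.weight a δ : ℝ) : ℂ) • monomial δ c := by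
  induction δ using Finsupp.induction_linear generalizing c with
  | zero =>
    rw [monomial_zero', ← algebraMap_eq, Derivation.map_algebraMap]
    simp
  | add f g hf hg =>
    have : (monomial (f + g) c : MvPolynomial σ ℂ) = monomial f c * monomial g 1 := by
      rw [monomial_mul, mul_one]
    rw [this, Derivation.leibniz, hf, hg, map_add]
    push_cast
    simp only [smul_eq_mul, Algebra.smul_def, map_add]
    ring
  | single i n =>
    rw [← C_mul_X_pow_eq_monomial, ← smul_eq_C_mul, Derivation.map_smul, Derivation.leibniz_pow,
      eulerField_X, Finsupp.weight_single]
    cases n with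
    | zero => simp
    | succ n =>
      simp only [smul_eq_mul, nsmul_eq_mul, smul_eq_C_mul, Nat.add_sub_cancel]
      push_cast
      simp only [ map_mul, map_add, map_natCast, map_one]
      ring

theorem coeff_eulerField (a : σ → ℝ) (δ : σ →₀ ℕ) (g : MvPolynomial σ ℂ) :
    coeff δ (eulerField a g) = ((Finsupp.weight a δ : ℝ) : ℂ) * coeff δ g := by
  classical
  induction g using MvPolynomial.induction_on' with
  | monomial α c =>
    rw [eulerField_monomial, coeff_smul, coeff_monomial, smul_eq_mul]
    split_ifs with h
    · rw [h]
    · simp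
  | add p q hp hq => rw [map_add, coeff_add, coeff_add, hp, hq, mul_add]

theorem lie_smul_eq {S : Type*} [CommRing S] [Algebra ℂ S] (f : S) (D w : Derivation ℂ S S) :
    ⁅f • D, w⁆ = f • ⁅D, w⁆ - w f • D := by
  ext x
  simp only [Derivation.commutator_apply, Derivation.smul_apply, Derivation.sub_apply, smul_eq_mul,
    Derivation.leibniz]
  ring

theorem lie_smul_eq' {S : Type*} [CommRing S] [Algebra ℂ S] (f : S) (D w : Derivation ℂ S S) :
    ⁅D, f • w⁆ = D f • w + f • ⁅D, w⁆ := by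
  ext x
  simp only [Derivation.commutator_apply, Derivation.smul_apply, Derivation.add_apply, smul_eq_mul,
    Derivation.leibniz]
  ring

theorem partialTerm_X [DecidableEq σ] (α : σ →₀ ℕ) (i k : σ) :
    partialTerm α i (X k) = if i = k then monomial α 1 else 0 := by
  rw [partialTerm, Derivation.smul_apply, pderiv_X, Pi.single_apply]
  simp [eq_comm]

theorem lie_eulerField_partialTerm (a : σ → ℝ) (α : σ →₀ ℕ) (i : σ) :
    ⁅eulerField a, partialTerm α i⁆ =
      ((Finsupp.weight a α - a i : ℝ) : ℂ) • partialTerm α i := by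
  classical
  refine MvPolynomial.derivation_ext fun k => ?_
  rw [Derivation.commutator_apply, Derivation.smul_apply, eulerField_X, Derivation.map_smul, partialTerm_X]
  split_ifs with h
  · subst h
    rw [eulerField_monomial, ← sub_smul]
    push_cast
    rfl
  · simp

theorem smul_derivation_eq_zero {f : MvPolynomial σ ℂ} {w : PolyDer σ} (h : f • w = 0) :
    f = 0 ∨ w = 0 := by
  rw [or_iff_not_imp_left]
  intro hf
  ext k : 1
  have := DFunLike.congr_fun h (X k)
  simpa [hf] using this

/-- The weights `a` are positive on `S`, zero elsewhere, and independent over `ℕ` on `S`. -/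
structure IsGenericWeight (S : Finset σ) (a : σ → ℝ) : Prop where
  eq_zero : ∀ i ∉ S, a i = 0
  pos : ∀ i ∈ S, 0 < a i
  inj : ∀ δ ε : σ →₀ ℕ, Finsupp.weight a δ = Finsupp.weight a ε → ∀ i ∈ S, δ i = ε i

variable {S : Finset σ} {a : σ → ℝ}

theorem IsGenericWeight.weight_pos (ha : IsGenericWeight S a) {δ : σ →₀ ℕ} (hδ : δ.support ⊆ S)
    (h0 : δ ≠ 0) : 0 < Finsupp.weight a δ := by
  rw [Finsupp.weight_apply]
  refine Finset.sum_pos (fun i hi => ?_) (Finsupp.support_nonempty_iff.2 h0)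
  have h1 := ha.pos i (hδ hi)
  have h2 : 0 < δ i := Nat.pos_of_ne_zero (Finsupp.mem_support_iff.1 hi)
  exact nsmul_pos h1 h2.ne'

theorem IsGenericWeight.eq_of_weight_eq (ha : IsGenericWeight S a) {δ ε : σ →₀ ℕ}
    (hδ : δ.support ⊆ S) (hε : ε.support ⊆ S)
    (h : Finsupp.weight a δ = Finsupp.weight a ε) : δ = ε := by
  ext i
  by_cases hi : i ∈ S
  · exact ha.inj δ ε h i hi
  · rw [Finsupp.notMem_support_iff.1 fun h => hi (hδ h),
      Finsupp.notMem_support_iff.1 fun h => hi (hε h)]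

/-- Genericity makes every monomial of an eigenvector agree with `δ` in the variables of `S`; the
variables outside `S` remain free. -/
theorem IsGenericWeight.monomial_dvd (ha : IsGenericWeight S a) {δ : σ →₀ ℕ}
    (hδ : δ.support ⊆ S) {g : MvPolynomial σ ℂ}
    (hg : eulerField a g = ((Finsupp.weight a δ : ℝ) : ℂ) • g) : monomial δ 1 ∣ g := by
  rw [g.as_sum]
  refine Finset.dvd_sum fun ε hε => monomial_dvd_monomial.2 ⟨Or.inr ?_, one_dvd _⟩
  have h := coeff_eulerField a ε g
  rw [hg, coeff_smul, smul_eq_mul] at h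
  have h2 := mul_right_cancel₀ (mem_support_iff.1 hε) h
  intro i
  by_cases hi : i ∈ S
  · exact (ha.inj δ ε (by exact_mod_cast h2) i hi).le
  · rw [Finsupp.notMem_support_iff.1 fun h => hi (hδ h)]
    exact Nat.zero_le _

/-- The vector fields of nonzero weight that commute with `t^β E`. -/
theorem IsGenericWeight.eq_smul_of_lie_eq_zero (ha : IsGenericWeight S a) {β : σ →₀ ℕ}
    (hβ : β.support ⊆ S) (hβ0 : β ≠ 0) {w : PolyDer σ} {r : ℝ} (hr : r ≠ 0)
    (hw : ⁅eulerField a, w⁆ = (r : ℂ) • w)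
    (hc : ⁅(monomial β (1 : ℂ)) • eulerField a, w⁆ = 0) :
    w = 0 ∨ r = Finsupp.weight a β ∧ ∃ p : MvPolynomial σ ℂ, eulerField a p = 0 ∧
      w = p • (monomial β (1 : ℂ)) • eulerField a := by
  classical
  set E := eulerField a with hE
  set m : MvPolynomial σ ℂ := monomial β 1 with hm
  set b := Finsupp.weight a β with hb
  have hb0 : b ≠ 0 := (ha.weight_pos hβ hβ0).ne'
  have hm0 : m ≠ 0 := by simp [hm]
  have hEm : E m = C (b : ℂ) * m := by rw [hE, hm, eulerField_monomial, smul_eq_C_mul]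
  rw [lie_smul_eq, hw] at hc
  -- Expanding the commutation relation gives `r m w = w(m) E`. Evaluated at `m`, it yields `(r - b)
  -- m w(m) = 0`, whence the case split on `r = b`.
  have hev : ∀ f, C (r : ℂ) * m * w f = w m * E f := by
    intro f
    have := DFunLike.congr_fun hc f
    simp only [Derivation.sub_apply, Derivation.smul_apply, smul_eq_mul, smul_eq_C_mul,
      Derivation.zero_apply] at this
    linear_combination this
  have hCr : (C (r : ℂ) : MvPolynomial σ ℂ) ≠ 0 := by simpa using hr
  have hCb : (C (b : ℂ) : MvPolynomial σ ℂ) ≠ 0 := by simpa using hb0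
  have h1 := hev m
  rw [hEm] at h1
  by_cases hrb : r = b
  · right
    refine ⟨hrb, ?_⟩
    -- Here `w(m)` has weight `2b`, hence is `m² p` with `p` of weight zero. Cancelling `m` in `r m
    -- w = m² p E` gives `w = r⁻¹ p m E`.
    have hEw : E (w m) = ((Finsupp.weight a (β + β) : ℝ) : ℂ) • w m := by
      have := DFunLike.congr_fun hw m
      rw [Derivation.commutator_apply, hEm, Derivation.smul_apply, Derivation.leibniz,
        ← algebraMap_eq, Derivation.map_algebraMap, algebraMap_eq, smul_zero, add_zero] at this
      rw [map_add, ← hb]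
      push_cast
      rw [smul_eq_mul, smul_eq_C_mul, hrb] at this
      rw [add_smul, smul_eq_C_mul]
      linear_combination this
    obtain ⟨p, hp⟩ := ha.monomial_dvd
      (Finsupp.support_add.trans (Finset.union_subset hβ hβ)) hEw
    have hmm : (monomial (β + β) (1 : ℂ)) = m * m := by rw [hm, monomial_mul, one_mul]
    refine ⟨C ((r : ℂ)⁻¹) * p, ?_, ?_⟩
    · rw [hp, hmm] at hEw
      simp only [Derivation.leibniz, hEm, smul_eq_mul, map_add, ← hb, smul_eq_C_mul] at hEw
      push_cast at hEw
      rw [map_add] at hEw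
      have : m * m * E p = 0 := by linear_combination hEw
      rw [Derivation.leibniz, ← algebraMap_eq, Derivation.map_algebraMap,
        (mul_eq_zero.1 this).resolve_left (mul_ne_zero hm0 hm0)]
      simp
    · refine MvPolynomial.derivation_ext fun k => ?_
      have h2 := hev (X k)
      rw [hp, hmm] at h2
      refine mul_left_cancel₀ (mul_ne_zero hCr hm0) ?_
      have hri : (C (r : ℂ) * C ((r : ℂ)⁻¹) : MvPolynomial σ ℂ) = 1 := by
        rw [← map_mul, mul_inv_cancel₀ (by exact_mod_cast hr), map_one]
      simp only [Derivation.smul_apply, smul_eq_mul]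
      linear_combination h2 - m * m * p * E (X k) * hri
  · left
    have h3 : C ((r - b : ℝ) : ℂ) * m * w m = 0 := by
      push_cast
      rw [map_sub]
      linear_combination h1
    have h4 : (C ((r - b : ℝ) : ℂ) : MvPolynomial σ ℂ) ≠ 0 := by
      simpa [sub_eq_zero] using hrb
    have h5 := (mul_eq_zero.1 h3).resolve_left (mul_ne_zero h4 hm0)
    refine MvPolynomial.derivation_ext fun k => ?_
    have h2 := hev (X k)
    rw [h5, zero_mul] at h2
    simpa using (mul_eq_zero.1 h2).resolve_left (mul_ne_zero hCr hm0)

/-- Real numbers linearly independent over `ℚ` serve as weights on `S`, because `ℝ` has infinite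
dimension over `ℚ`. Changing signs makes them positive without losing independence. -/
theorem exists_isGenericWeight [Countable σ] (S : Finset σ) : ∃ a : σ → ℝ, IsGenericWeight S a := by
  classical
  obtain ⟨e, he⟩ := exists_injective_nat σ
  obtain ⟨b, hb⟩ : ∃ b : σ → ℝ, LinearIndependent ℚ b := by
    have hinf : Infinite (Module.Free.ChooseBasisIndex ℚ ℝ) := by
      rw [← Cardinal.aleph0_le_mk_iff, ← Module.Free.rank_eq_card_chooseBasisIndex,
        Real.rank_rat_real]
      exact Cardinal.aleph0_le_continuum
    refine ⟨_, (Module.Free.chooseBasis ℚ ℝ).linearIndependent.comp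
      (fun i => Infinite.natEmbedding _ (e i)) fun i j h => he ?_⟩
    exact (Infinite.natEmbedding _).injective h
  let u : σ → ℚˣ := fun i => if 0 < b i then 1 else -1
  have hu := hb.units_smul u
  have hc : LinearIndependent ℕ (u • b) :=
    hu.restrict_scalars (R := ℕ) fun m n h => by simpa using h
  have hpos : ∀ i, 0 < (u • b) i := by
    intro i
    have h0 := hb.ne_zero i
    by_cases h : 0 < b i
    · simp [u, h]
    · simp [u, h, Units.smul_def]
      exact lt_of_le_of_ne (not_lt.1 h) h0
  refine ⟨fun i => if i ∈ S then (u • b) i else 0, fun i hi => if_neg hi, fun i hi => ?_, ?_⟩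
  · simpa [hi] using hpos i
  · intro δ ε h i hi
    have key : ∀ δ : σ →₀ ℕ, Finsupp.weight (fun i => if i ∈ S then (u • b) i else 0) δ =
        Finsupp.linearCombination ℕ (u • b) (δ.filter (· ∈ S)) := by
      intro δ
      induction δ using Finsupp.induction_linear with
      | zero => rw [map_zero, Finsupp.filter_zero, map_zero]
      | add f g hf hg => rw [map_add, Finsupp.filter_add, map_add, hf, hg]
      | single j n =>
        by_cases hj : j ∈ S
        · rw [Finsupp.filter_single_of_pos _ hj]; simp [hj, Finsupp.weight_single]
        · rw [Finsupp.filter_single_of_neg _ hj]; simp [hj, Finsupp.weight_single]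
    rw [key, key] at h
    have := DFunLike.congr_fun (hc h) i
    simpa [hi] using this

end EulerField

/-! ### Algebras of Witt type and derivations killing the monomial multiples of `E`. -/

section WittType

variable {σ : Type}

/-- `L` is spanned by the `t^α ∂/∂t_i` with `(α, i) ∈ P`, where `P` is stable under multiplication
by monomials and contains all `(α, i)` with `t_i ∣ t^α`. -/
structure IsWittType (P : Set ((σ →₀ ℕ) × σ)) (L : LieSubalgebra ℂ (PolyDer σ)) : Prop where
  toSubmodule_eq : L.toSubmodule =
    Submodule.span ℂ ((fun q : (σ →₀ ℕ) × σ => partialTerm q.1 q.2) '' P)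
  mem_of_ne_zero : ∀ (α : σ →₀ ℕ) (i : σ), α i ≠ 0 → (α, i) ∈ P
  add_mem : ∀ (α β : σ →₀ ℕ) (i : σ), (α, i) ∈ P → (β + α, i) ∈ P

/-- The part of the span of the `t^α ∂/∂t_i`, `(α, i) ∈ P`, in the variables from `S`. -/
noncomputable def localPart (P : Set ((σ →₀ ℕ) × σ)) (S : Finset σ) : Submodule ℂ (PolyDer σ) :=
  Submodule.span ℂ ((fun q : (σ →₀ ℕ) × σ => partialTerm q.1 q.2) ''
    {q | q ∈ P ∧ q.1.support ⊆ S ∧ q.2 ∈ S})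

theorem localPart_mono (P : Set ((σ →₀ ℕ) × σ)) {S T : Finset σ} (h : S ⊆ T) :
    localPart P S ≤ localPart P T :=
  Submodule.span_mono (Set.image_mono fun _ hq => ⟨hq.1, hq.2.1.trans h, h hq.2.2⟩)

theorem monomial_smul_partialTerm (β α : σ →₀ ℕ) (i : σ) (c : ℂ) :
    (monomial β c : MvPolynomial σ ℂ) • partialTerm α i = c • partialTerm (β + α) i := by
  rw [partialTerm, smul_smul, monomial_mul, mul_one, partialTerm, ← smul_assoc, smul_monomial,
    smul_eq_mul, mul_one]

theorem eulerField_eq_sum {S : Finset σ} {a : σ → ℝ} (ha : ∀ i ∉ S, a i = 0) :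
    eulerField a = ∑ i ∈ S, (a i : ℂ) • partialTerm (Finsupp.single i 1) i := by
  classical
  refine MvPolynomial.derivation_ext fun k => ?_
  rw [← Derivation.coeFnAddMonoidHom_apply (∑ i ∈ S, _), map_sum, Finset.sum_apply]
  simp only [Derivation.coeFnAddMonoidHom_apply, Derivation.smul_apply, partialTerm_X,
    eulerField_X, smul_ite, smul_zero, Finset.sum_ite_eq']
  split_ifs with h
  · rfl
  · simp [ha k h]

theorem eulerField_apply_X_eq_zero {a : σ → ℝ} {w : PolyDer σ} (hw : ⁅eulerField a, w⁆ = 0) {k : σ}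
    (hk : a k = 0) : eulerField a (w (X k)) = 0 := by
  have := DFunLike.congr_fun hw (X k)
  simpa [Derivation.commutator_apply, hk] using this

namespace IsGenericWeight

variable {S : Finset σ} {a : σ → ℝ}

theorem pderiv_eq_zero (ha : IsGenericWeight S a) {p : MvPolynomial σ ℂ}
    (hp : eulerField a p = 0) {i : σ} (hi : i ∈ S) : pderiv i p = 0 := by
  rw [p.as_sum, map_sum]
  refine Finset.sum_eq_zero fun ε hε => ?_
  have h := coeff_eulerField a ε p
  rw [hp, coeff_zero, eq_comm, mul_eq_zero] at h
  have h2 : Finsupp.weight a ε = Finsupp.weight a (0 : σ →₀ ℕ) := by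
    rw [map_zero]; exact_mod_cast h.resolve_right (mem_support_iff.1 hε)
  rw [pderiv_monomial, ha.inj ε 0 h2 i hi]
  simp

/-- A polynomial of weight zero is free of the variables in `S`, hence a constant for fields that
differentiate only along them. -/
theorem localPart_apply_eq_zero (ha : IsGenericWeight S a) {P : Set ((σ →₀ ℕ) × σ)}
    {p : MvPolynomial σ ℂ} (hp : eulerField a p = 0) {y : PolyDer σ} (hy : y ∈ localPart P S) :
    y p = 0 := by
  induction hy using Submodule.span_induction with
  | mem y hy =>
    obtain ⟨⟨α, i⟩, ⟨-, -, hi⟩, rfl⟩ := hy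
    simp [partialTerm, ha.pderiv_eq_zero hp hi]
  | zero => simp
  | add x y _ _ h h' => simp [h, h']
  | smul c x _ h => simp [h]

end IsGenericWeight

namespace IsWittType

variable {P : Set ((σ →₀ ℕ) × σ)} {L : LieSubalgebra ℂ (PolyDer σ)}

theorem partialTerm_mem (hL : IsWittType P L) {α : σ →₀ ℕ} {i : σ} (h : (α, i) ∈ P) :
    partialTerm α i ∈ L := by
  rw [← LieSubalgebra.mem_toSubmodule, hL.toSubmodule_eq]
  exact Submodule.subset_span ⟨(α, i), h, rfl⟩

theorem exists_mem_localPart (hL : IsWittType P L) {y : PolyDer σ} (hy : y ∈ L) :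
    ∃ S : Finset σ, y ∈ localPart P S := by
  classical
  rw [← LieSubalgebra.mem_toSubmodule, hL.toSubmodule_eq] at hy
  induction hy using Submodule.span_induction with
  | mem y hy =>
    obtain ⟨⟨α, i⟩, h, rfl⟩ := hy
    exact ⟨insert i α.support, Submodule.subset_span ⟨(α, i),
      ⟨h, Finset.subset_insert _ _, Finset.mem_insert_self _ _⟩, rfl⟩⟩
  | zero => exact ⟨∅, zero_mem _⟩
  | add x y _ _ h h' =>
    obtain ⟨S, hS⟩ := h
    obtain ⟨T, hT⟩ := h'
    exact ⟨S ∪ T, Submodule.add_mem _ (localPart_mono P Finset.subset_union_left hS)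
      (localPart_mono P Finset.subset_union_right hT)⟩
  | smul c x _ h =>
    obtain ⟨S, hS⟩ := h
    exact ⟨S, Submodule.smul_mem _ _ hS⟩

theorem smul_mem (hL : IsWittType P L) (f : MvPolynomial σ ℂ) {w : PolyDer σ} (hw : w ∈ L) :
    f • w ∈ L := by
  rw [← LieSubalgebra.mem_toSubmodule] at hw ⊢
  rw [hL.toSubmodule_eq] at hw
  induction hw using Submodule.span_induction with
  | mem y hy =>
    obtain ⟨⟨α, i⟩, h, rfl⟩ := hy
    induction f using MvPolynomial.induction_on' with
    | monomial β c =>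
      simp only [monomial_smul_partialTerm]
      exact Submodule.smul_mem _ _ (hL.partialTerm_mem (hL.add_mem _ _ _ h))
    | add p q hp hq => rw [add_smul]; exact Submodule.add_mem _ hp hq
  | zero => simp
  | add x y _ _ h h' => rw [smul_add]; exact Submodule.add_mem _ h h'
  | smul c x _ h => rw [smul_comm]; exact Submodule.smul_mem _ _ h

/-- Multiplication of an element of `L` by a polynomial. -/
noncomputable def mul (hL : IsWittType P L) (f : MvPolynomial σ ℂ) (w : L) : L :=
  ⟨f • (w : PolyDer σ), hL.smul_mem f w.2⟩

@[simp]
theorem coe_mul (hL : IsWittType P L) (f : MvPolynomial σ ℂ) (w : L) :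
    (hL.mul f w : PolyDer σ) = f • (w : PolyDer σ) := rfl

theorem partialTerm_single_mem (hL : IsWittType P L) (k : σ) {n : ℕ} (hn : n ≠ 0) :
    partialTerm (Finsupp.single k n) k ∈ L :=
  hL.partialTerm_mem (hL.mem_of_ne_zero _ _ (by simpa using hn))

theorem eulerField_mem (hL : IsWittType P L) {S : Finset σ} {a : σ → ℝ} (ha : ∀ i ∉ S, a i = 0) :
    eulerField a ∈ L := by
  rw [eulerField_eq_sum ha]
  exact L.toSubmodule.sum_mem fun i _ =>
    Submodule.smul_mem _ _ (hL.partialTerm_single_mem i one_ne_zero)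

/-- With `g = w(t_k)`, the cases `n = 1, 2` read `t_k ∂_k g = g` and `t_k² ∂_k g = 2 t_k g`, so `t_k
g = 0`. The hypothesis is what commuting with `t_k^n ∂_k` says at `t_k`. -/
theorem apply_X_eq_zero {w : PolyDer σ} {k : σ}
    (h : ∀ n ≠ 0, partialTerm (Finsupp.single k n) k (w (X k)) = w (X k ^ n)) : w (X k) = 0 := by
  have h1 := h 1 one_ne_zero
  have h2 := h 2 two_ne_zero
  simp only [partialTerm, Derivation.smul_apply, smul_eq_mul, ← X_pow_eq_monomial, pow_one,
    Derivation.leibniz_pow, nsmul_eq_mul, Nat.cast_ofNat, Nat.add_one_sub_one] at h1 h2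
  have : X k * w (X k) = 0 := by linear_combination X k * h1 - h2
  exact (mul_eq_zero.1 this).resolve_left (X_ne_zero k)

theorem eq_zero_of_lie_eq_zero (hL : IsWittType P L) {x : L} (h : ∀ y : L, ⁅x, y⁆ = 0) :
    x = 0 := by
  classical
  refine Subtype.ext (MvPolynomial.derivation_ext fun k => apply_X_eq_zero fun n hn => ?_)
  have h1 := congrArg Subtype.val (h ⟨_, hL.partialTerm_single_mem k hn⟩)
  have h2 := DFunLike.congr_fun h1 (X k)
  simp only [LieSubalgebra.coe_bracket, Derivation.commutator_apply, partialTerm_X, if_true,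
    ← X_pow_eq_monomial] at h2
  exact (sub_eq_zero.1 h2).symm

variable {S : Finset σ} {a : σ → ℝ} {e : L}

theorem mem_realWeightSpace_iff (he : (e : PolyDer σ) = eulerField a) {w : L} {r : ℝ} :
    w ∈ realWeightSpace e r ↔ ⁅eulerField a, (w : PolyDer σ)⁆ = (r : ℂ) • (w : PolyDer σ) := by
  rw [mem_realWeightSpace, Subtype.ext_iff, LieSubalgebra.coe_bracket, he]
  rfl

theorem weightSpan_univ (hL : IsWittType P L) (he : (e : PolyDer σ) = eulerField a) :
    weightSpan e Set.univ = ⊤ := by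
  refine eq_top_iff.2 fun y _ => ?_
  suffices h : (y : PolyDer σ) ∈ (weightSpan e Set.univ).map L.toSubmodule.subtype by
    obtain ⟨z, hz, hzy⟩ := h
    rwa [Subtype.ext hzy] at hz
  have hy := y.2
  rw [← LieSubalgebra.mem_toSubmodule, hL.toSubmodule_eq] at hy
  refine Submodule.span_le.2 ?_ hy
  rintro _ ⟨⟨α, i⟩, h, rfl⟩
  refine ⟨⟨_, hL.partialTerm_mem h⟩, realWeightSpace_le_weightSpan e (Set.mem_univ _)
    ((mem_realWeightSpace_iff he).2 (lie_eulerField_partialTerm a α i)), rfl⟩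

theorem mul_mem_realWeightSpace (hL : IsWittType P L) (he : (e : PolyDer σ) = eulerField a)
    {f : MvPolynomial σ ℂ} {b r : ℝ} (hf : eulerField a f = (b : ℂ) • f) {w : L}
    (hw : w ∈ realWeightSpace e r) : hL.mul f w ∈ realWeightSpace e (b + r) := by
  rw [mem_realWeightSpace_iff he] at hw ⊢
  rw [coe_mul, lie_smul_eq', hf, hw, smul_assoc, smul_comm f, ← add_smul]
  push_cast
  rfl

/-- Apply `D` to `[f E, w] = r f w - w(f) E`, and expand `[f E, D w]` in the same way, `D w` again
having weight `r`. This measures how far `D` is from being linear over polynomials. -/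
theorem smul_derivation_apply_mul (hL : IsWittType P L) (he : (e : PolyDer σ) = eulerField a)
    {D : LieDerivation ℂ L L} (hD : D e = 0) {w : L} {r : ℝ} (hw : w ∈ realWeightSpace e r)
    {f : MvPolynomial σ ℂ} (h1 : D (hL.mul f e) = 0)
    (h2 : D (hL.mul ((w : PolyDer σ) f) e) = 0) :
    (r : ℂ) • (D (hL.mul f w) : PolyDer σ) =
      f • (r : ℂ) • (D w : PolyDer σ) - (D w : PolyDer σ) f • eulerField a := by
  have hlie : ∀ v : L, v ∈ realWeightSpace e r →
      ⁅hL.mul f e, v⁆ = (r : ℂ) • hL.mul f v - hL.mul ((v : PolyDer σ) f) e := by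
    intro v hv
    refine Subtype.ext ?_
    rw [LieSubalgebra.coe_bracket, coe_mul, he, lie_smul_eq, (mem_realWeightSpace_iff he).1 hv,
      smul_comm f, ← he]
    rfl
  have h3 := D.apply_lie_eq_add (hL.mul f e) w
  rw [h1, zero_lie, add_zero, hlie w hw, hlie (D w) (D.mem_realWeightSpace hD hw), map_sub, h2,
    sub_zero, map_smul] at h3
  have h4 := congrArg Subtype.val h3
  rw [smul_comm f, ← he]
  exact h4

theorem derivation_partialTerm_eq_zero (hL : IsWittType P L) (ha : IsGenericWeight S a)
    (he : (e : PolyDer σ) = eulerField a) {D : LieDerivation ℂ L L} (hD : D e = 0)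
    (hkill : ∀ (δ : σ →₀ ℕ) (c : ℂ), δ.support ⊆ S → D (hL.mul (monomial δ c) e) = 0)
    {α : σ →₀ ℕ} {j : σ} (hα : (α, j) ∈ P) (hαS : α.support ⊆ S) (hj : j ∈ S) :
    D ⟨partialTerm α j, hL.partialTerm_mem hα⟩ = 0 := by
  classical
  set w : L := ⟨partialTerm α j, hL.partialTerm_mem hα⟩ with hw
  set r : ℝ := Finsupp.weight a α - a j
  have hwr : w ∈ realWeightSpace e r :=
    (mem_realWeightSpace_iff he).2 (lie_eulerField_partialTerm a α j)
  refine Subtype.ext (MvPolynomial.derivation_ext fun i => ?_)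
  change (D w : PolyDer σ) (X i) = 0
  by_cases hi : i ∈ S
  · have hX : ∀ n : ℕ, (X i ^ n : MvPolynomial σ ℂ) = monomial (Finsupp.single i n) 1 :=
      fun n => X_pow_eq_monomial
    have hXS : ∀ n : ℕ, (Finsupp.single i n).support ⊆ S := fun n =>
      Finsupp.support_single_subset.trans (by simpa using hi)
    have hsup : ∀ n : ℕ, (Finsupp.single i n + α).support ⊆ S := fun n =>
      Finsupp.support_add.trans (Finset.union_subset (hXS n) hαS)
    obtain ⟨c, hc⟩ : ∃ c : ℂ, (w : PolyDer σ) (X i) = monomial α c := by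
      rw [hw, partialTerm_X]
      split_ifs
      · exact ⟨1, rfl⟩
      · exact ⟨0, by simp⟩
    have hEX : eulerField a (X i) = ((a i : ℝ) : ℂ) • X i := eulerField_X a i
    have e1 := hL.smul_derivation_apply_mul he hD hwr (f := X i)
      (by rw [← pow_one (X i), hX]; exact hkill _ _ (hXS 1)) (by rw [hc]; exact hkill _ _ hαS)
    have e2 := hL.smul_derivation_apply_mul he hD hwr (f := X i * X i)
      (by rw [← pow_two, hX]; exact hkill _ _ (hXS 2)) (by
        rw [Derivation.leibniz, hc, smul_eq_mul, ← mul_add, ← map_add, ← pow_one (X i), hX,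
          monomial_mul]
        exact hkill _ _ (hsup 1))
    have e3 := hL.smul_derivation_apply_mul he hD (hL.mul_mem_realWeightSpace he hEX hwr)
      (f := X i) (by rw [← pow_one (X i), hX]; exact hkill _ _ (hXS 1)) (by
        rw [coe_mul, Derivation.smul_apply, hc, smul_eq_mul, ← pow_one (X i), hX, monomial_mul]
        exact hkill _ _ (hsup 1))
    have hmm : hL.mul (X i) (hL.mul (X i) w) = hL.mul (X i * X i) w :=
      Subtype.ext (smul_smul _ _ _)
    rw [hmm] at e3
    replace e1 := DFunLike.congr_fun e1 (X i)
    replace e2 := DFunLike.congr_fun e2 (X i)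
    replace e3 := DFunLike.congr_fun e3 (X i)
    simp only [Derivation.smul_apply, Derivation.sub_apply, Derivation.leibniz, hEX, smul_eq_mul,
      smul_eq_C_mul, Complex.ofReal_add, map_add] at e1 e2 e3
    -- `D (t_i² w)` is computed in one step and by two multiplications by `t_i`. Eliminating `D (t_i
    -- w)` and `D (t_i² w)` leaves `2 a_i² t_i² (D w)(t_i) = 0`. No division by `r` occurs, so zero
    -- weights need no separate treatment.
    have hz : C ((a i : ℝ) : ℂ) * C ((a i : ℝ) : ℂ) * (X i * X i) * (D w : PolyDer σ) (X i) = 0 := by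
      have : (2 : MvPolynomial σ ℂ) ≠ 0 := two_ne_zero
      refine (mul_eq_zero.1 ?_).resolve_left this
      linear_combination (C (a i : ℂ) + C (r : ℂ)) * e2 - C (r : ℂ) * e3 - X i * C (r : ℂ) * e1
    have hai : (C ((a i : ℝ) : ℂ) : MvPolynomial σ ℂ) ≠ 0 := by
      simpa using (ha.pos i hi).ne'
    exact (mul_eq_zero.1 hz).resolve_left
      (mul_ne_zero (mul_ne_zero hai hai) (mul_ne_zero (X_ne_zero i) (X_ne_zero i)))
  -- For `i ∉ S`, the field `q = t_i^n ∂_i` has weight zero and commutes with `w`. Evaluate `[q, D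
  -- w] + [D q, w] = 0` at `t_i`: the second bracket contributes nothing, because `(D q)(t_i)` has
  -- weight zero and `w` kills it.
  · refine apply_X_eq_zero fun n hn => ?_
    have hji : j ≠ i := fun h => hi (h ▸ hj)
    set q : L := ⟨_, hL.partialTerm_single_mem i hn⟩ with hq
    have hai := ha.eq_zero i hi
    have hq0 : q ∈ realWeightSpace e 0 := by
      rw [mem_realWeightSpace_iff he, hq, lie_eulerField_partialTerm, Finsupp.weight_single, hai]
      simp
    have hqw : ⁅q, w⁆ = 0 := by
      refine Subtype.ext ?_
      rw [LieSubalgebra.coe_bracket, hq, hw, lie_partialTerm,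
        Finsupp.notMem_support_iff.1 fun h => hi (hαS h), Finsupp.single_eq_of_ne hji]
      simp
    have h1 := D.apply_lie_eq_add q w
    rw [hqw, map_zero] at h1
    have h2 := DFunLike.congr_fun (congrArg Subtype.val h1) (X i)
    have h3 := (mem_realWeightSpace_iff he).1 (D.mem_realWeightSpace hD hq0)
    rw [Complex.ofReal_zero, zero_smul] at h3
    have h4 : (w : PolyDer σ) ((D q : PolyDer σ) (X i)) = 0 :=
      ha.localPart_apply_eq_zero (eulerField_apply_X_eq_zero h3 hai)
        (Submodule.subset_span ⟨(α, j), ⟨hα, hαS, hj⟩, rfl⟩ : _ ∈ localPart P S)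
    have h5 : (w : PolyDer σ) (X i) = 0 := by rw [hw, partialTerm_X, if_neg hji]
    have h6 : (q : PolyDer σ) (X i) = X i ^ n := by
      rw [hq, partialTerm_X, if_pos rfl, X_pow_eq_monomial]
    rw [AddMemClass.coe_add, LieSubalgebra.coe_bracket, LieSubalgebra.coe_bracket,
      Derivation.add_apply, Derivation.commutator_apply, Derivation.commutator_apply, h4, h5, h6,
      map_zero, sub_zero, add_zero] at h2
    exact sub_eq_zero.1 h2.symm

theorem derivation_eq_zero_of_mem_localPart (hL : IsWittType P L) (ha : IsGenericWeight S a)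
    (he : (e : PolyDer σ) = eulerField a) {D : LieDerivation ℂ L L} (hD : D e = 0)
    (hkill : ∀ (δ : σ →₀ ℕ) (c : ℂ), δ.support ⊆ S → D (hL.mul (monomial δ c) e) = 0)
    {y : L} (hy : (y : PolyDer σ) ∈ localPart P S) : D y = 0 := by
  suffices h : (y : PolyDer σ) ∈ (LinearMap.ker D.toLinearMap).map L.toSubmodule.subtype by
    obtain ⟨z, hz, hzy⟩ := h
    rw [← show z = y from Subtype.ext hzy]
    exact hz
  refine Submodule.span_le.2 ?_ hy
  rintro _ ⟨⟨α, i⟩, ⟨h, hS, hi⟩, rfl⟩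
  exact ⟨⟨_, hL.partialTerm_mem h⟩,
    hL.derivation_partialTerm_eq_zero ha he hD hkill h hS hi, rfl⟩

end IsWittType

end WittType

/-! ### Rigidity of derivations that kill a sum of monomial multiples of `E`. -/

namespace IsWittType

variable {σ : Type} {P : Set ((σ →₀ ℕ) × σ)} {L : LieSubalgebra ℂ (PolyDer σ)}
variable {S : Finset σ} {a : σ → ℝ} {e : L}

theorem mul_add (hL : IsWittType P L) (f : MvPolynomial σ ℂ) (x y : L) :
    hL.mul f (x + y) = hL.mul f x + hL.mul f y :=
  Subtype.ext (smul_add _ _ _)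

theorem mul_zero (hL : IsWittType P L) (f : MvPolynomial σ ℂ) : hL.mul f 0 = 0 :=
  Subtype.ext (smul_zero _)

theorem add_mul (hL : IsWittType P L) (f g : MvPolynomial σ ℂ) (x : L) :
    hL.mul (f + g) x = hL.mul f x + hL.mul g x :=
  Subtype.ext (add_smul _ _ _)

theorem zero_mul (hL : IsWittType P L) (x : L) : hL.mul 0 x = 0 :=
  Subtype.ext (zero_smul _ _)

theorem sum_mul (hL : IsWittType P L) {ι : Type*} (s : Finset ι) (f : ι → MvPolynomial σ ℂ)
    (x : L) : hL.mul (∑ i ∈ s, f i) x = ∑ i ∈ s, hL.mul (f i) x := by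
  classical
  induction s using Finset.induction_on with
  | empty => simp [zero_mul]
  | insert i s hi ih => rw [Finset.sum_insert hi, Finset.sum_insert hi, add_mul, ih]

theorem self_mem_realWeightSpace : e ∈ realWeightSpace e 0 :=
  mem_realWeightSpace.2 (by simp)

theorem mul_mem_weightSpan (hL : IsWittType P L) (he : (e : PolyDer σ) = eulerField a)
    {p : MvPolynomial σ ℂ} (hp : eulerField a p = 0) {A : Set ℝ} {w : L}
    (hw : w ∈ weightSpan e A) : hL.mul p w ∈ weightSpan e A := by
  refine weightSpan_induction hw (fun r hr x hx => ?_) ?_ ?_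
  · refine realWeightSpace_le_weightSpan e hr ?_
    have := hL.mul_mem_realWeightSpace he (f := p) (b := 0) (by simp [hp]) hx
    rwa [zero_add] at this
  · rw [mul_zero]; exact zero_mem _
  · intro x y hx hy
    rw [mul_add]; exact Submodule.add_mem _ hx hy

theorem monomial_mul_mem_realWeightSpace (hL : IsWittType P L)
    (he : (e : PolyDer σ) = eulerField a) (β : σ →₀ ℕ) (c : ℂ) :
    hL.mul (monomial β c) e ∈ realWeightSpace e (Finsupp.weight a β) := by
  have := hL.mul_mem_realWeightSpace he (eulerField_monomial a β c) self_mem_realWeightSpace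
  rwa [add_zero] at this

theorem eq_mul_of_lie_eq_zero (hL : IsWittType P L) (ha : IsGenericWeight S a)
    (he : (e : PolyDer σ) = eulerField a) {β : σ →₀ ℕ} (hβ : β.support ⊆ S) (hβ0 : β ≠ 0)
    {r : ℝ} (hr : r ≠ 0) {u : L} (hu : u ∈ realWeightSpace e r)
    (h : ⁅u, hL.mul (monomial β 1) e⁆ = 0) :
    u = 0 ∨ r = Finsupp.weight a β ∧ ∃ p : MvPolynomial σ ℂ, eulerField a p = 0 ∧
      u = hL.mul p (hL.mul (monomial β 1) e) := by
  have h' : ⁅hL.mul (monomial β 1) e, u⁆ = 0 := by rw [← lie_skew, h, neg_zero]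
  have h2 := congrArg Subtype.val h'
  rw [LieSubalgebra.coe_bracket, coe_mul, he] at h2
  rcases ha.eq_smul_of_lie_eq_zero hβ hβ0 hr ((mem_realWeightSpace_iff he).1 hu) h2 with
    h3 | ⟨h3, p, hp, h4⟩
  · exact Or.inl (Subtype.ext h3)
  · exact Or.inr ⟨h3, p, hp, Subtype.ext (by rw [h4, coe_mul, coe_mul, he])⟩

theorem lie_mul_mul (hL : IsWittType P L) (he : (e : PolyDer σ) = eulerField a)
    (f g : MvPolynomial σ ℂ) :
    ⁅hL.mul f e, hL.mul g e⁆ = hL.mul (f * eulerField a g - g * eulerField a f) e := by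
  refine Subtype.ext ?_
  rw [LieSubalgebra.coe_bracket, coe_mul, coe_mul, coe_mul, he, lie_smul_eq, lie_smul_eq', lie_self,
    Derivation.smul_apply, smul_zero, add_zero, smul_smul, smul_eq_mul, ← sub_smul]

theorem lie_mul_right_of_mem_localPart (hL : IsWittType P L) (ha : IsGenericWeight S a)
    {p : MvPolynomial σ ℂ} (hp : eulerField a p = 0) (z : L) {y : L}
    (hy : (y : PolyDer σ) ∈ localPart P S) : ⁅hL.mul p z, y⁆ = hL.mul p ⁅z, y⁆ := by
  refine Subtype.ext ?_
  rw [LieSubalgebra.coe_bracket, coe_mul, coe_mul, lie_smul_eq, ha.localPart_apply_eq_zero hp hy,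
    zero_smul, sub_zero, LieSubalgebra.coe_bracket]

theorem mul_eulerField_mem_localPart (hL : IsWittType P L) (ha : IsGenericWeight S a)
    (he : (e : PolyDer σ) = eulerField a) {δ : σ →₀ ℕ} (hδ : δ.support ⊆ S) (c : ℂ) :
    (hL.mul (monomial δ c) e : PolyDer σ) ∈ localPart P S := by
  classical
  rw [coe_mul, he, eulerField_eq_sum ha.eq_zero, Finset.smul_sum]
  refine Submodule.sum_mem _ fun i hi => ?_
  rw [smul_comm, monomial_smul_partialTerm]
  refine Submodule.smul_mem _ _ (Submodule.smul_mem _ _ (Submodule.subset_span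
    ⟨(_, i), ⟨hL.add_mem _ _ _ (hL.mem_of_ne_zero _ _ (by simp)), ?_, hi⟩, rfl⟩))
  exact Finsupp.support_add.trans (Finset.union_subset hδ
    (Finsupp.support_single_subset.trans (by simpa using hi)))

/-- Induction on degree by `[t_i E, t^ε E] = (wt ε - a_i) t_i t^ε E`. The factor vanishes only for
`t^ε = t_i`, which is why `t_i² E` must be assumed killed as well. -/
theorem derivation_monomial_mul_eq_zero (hL : IsWittType P L) (ha : IsGenericWeight S a)
    (he : (e : PolyDer σ) = eulerField a) {D : LieDerivation ℂ L L} (hD : D e = 0)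
    (h1 : ∀ i ∈ S, D (hL.mul (monomial (Finsupp.single i 1) 1) e) = 0)
    (h2 : ∀ i ∈ S, D (hL.mul (monomial (Finsupp.single i 2) 1) e) = 0)
    (δ : σ →₀ ℕ) (c : ℂ) (hδ : δ.support ⊆ S) : D (hL.mul (monomial δ c) e) = 0 := by
  classical
  have hc : hL.mul (monomial δ c) e = c • hL.mul (monomial δ 1) e := by
    refine Subtype.ext ?_
    change _ = c • (hL.mul (monomial δ 1) e : PolyDer σ)
    rw [coe_mul, coe_mul, ← smul_assoc, smul_monomial, smul_eq_mul, mul_one]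
  rw [hc, map_smul]
  suffices h : D (hL.mul (monomial δ 1) e) = 0 by rw [h, smul_zero]
  clear hc
  induction hn : δ.degree generalizing δ with
  | zero =>
    rw [(Finsupp.degree_eq_zero_iff δ).1 hn]
    have : hL.mul (monomial 0 1) e = e := Subtype.ext (one_smul _ _)
    rw [this, hD]
  | succ n ih =>
    have hδ0 : δ ≠ 0 := by rintro rfl; simp at hn
    obtain ⟨i, hi⟩ := Finsupp.support_nonempty_iff.2 hδ0
    have hiS := hδ hi
    have hle : Finsupp.single i 1 ≤ δ :=
      Finsupp.single_le_iff.2 (Nat.one_le_iff_ne_zero.2 (Finsupp.mem_support_iff.1 hi))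
    obtain ⟨ε, rfl⟩ := exists_add_of_le hle
    have hε : ε.support ⊆ S := (Finsupp.support_mono (self_le_add_left _ _)).trans hδ
    have hiS' : (Finsupp.single i 1).support ⊆ S :=
      Finsupp.support_single_subset.trans (by simpa using hiS)
    by_cases hw : Finsupp.weight a ε = Finsupp.weight a (Finsupp.single i 1)
    · rw [ha.eq_of_weight_eq hε hiS' hw, ← Finsupp.single_add]
      exact h2 i hiS
    · have hdeg : ε.degree = n := by
        rw [map_add, Finsupp.degree_single] at hn
        omega
      have h3 := D.apply_lie_eq_add (hL.mul (monomial (Finsupp.single i 1) 1) e)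
        (hL.mul (monomial ε 1) e)
      rw [h1 i hiS, ih ε hε hdeg, lie_zero, zero_lie, add_zero, hL.lie_mul_mul he,
        eulerField_monomial, eulerField_monomial] at h3
      have h4 : hL.mul (monomial (Finsupp.single i 1) (1 : ℂ) *
            ((Finsupp.weight a ε : ℝ) : ℂ) • monomial ε 1 - monomial ε (1 : ℂ) *
            ((Finsupp.weight a (Finsupp.single i 1) : ℝ) : ℂ) •
              monomial (Finsupp.single i 1) 1) e =
          ((Finsupp.weight a ε - Finsupp.weight a (Finsupp.single i 1) : ℝ) : ℂ) •
            hL.mul (monomial (Finsupp.single i 1 + ε) 1) e := by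
        refine Subtype.ext ?_
        change _ = _ • (hL.mul (monomial (Finsupp.single i 1 + ε) 1) e : PolyDer σ)
        rw [coe_mul, coe_mul, mul_smul_comm, mul_smul_comm, monomial_mul, monomial_mul, one_mul,
          add_comm ε, ← sub_smul, smul_assoc]
        push_cast
        rfl
      rw [h4, map_smul] at h3
      exact (smul_eq_zero.1 h3).resolve_left (by exact_mod_cast sub_ne_zero.2 hw)

theorem eq_zero_of_sum_eq_zero {ι : Type*} {s : Finset ι} {μ : ι → ℝ}
    (hμ : Set.InjOn μ s) {x : ι → L} (hx : ∀ i ∈ s, x i ∈ realWeightSpace e (μ i))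
    (h : ∑ i ∈ s, x i = 0) {i : ι} (hi : i ∈ s) : x i = 0 := by
  classical
  rw [← Finset.add_sum_erase s x hi] at h
  refine eq_zero_of_mem_weightSpan (e := e) (A := {μ i}) (B := {μ i}ᶜ) disjoint_compl_right
    (realWeightSpace_le_weightSpan e (Set.mem_singleton _) (hx i hi)) ?_
  rw [eq_neg_of_add_eq_zero_left h]
  refine Submodule.neg_mem _ (Submodule.sum_mem _ fun j hj => ?_)
  obtain ⟨hji, hj⟩ := Finset.mem_erase.1 hj
  exact realWeightSpace_le_weightSpan e (by exact fun h => hji (hμ hj hi h)) (hx j hj)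

/-- The vector field `∑_{β ∈ B} t^β E`. -/
noncomputable def monomialSum (hL : IsWittType P L) (e : L) (B : Finset (σ →₀ ℕ)) : L :=
  hL.mul (∑ β ∈ B, monomial β 1) e

theorem monomialSum_eq (hL : IsWittType P L) (B : Finset (σ →₀ ℕ)) :
    hL.monomialSum e B = ∑ β ∈ B, hL.mul (monomial β 1) e :=
  hL.sum_mul _ _ _

theorem monomialSum_eq_add_erase [DecidableEq σ] (hL : IsWittType P L) {B : Finset (σ →₀ ℕ)}
    {γ : σ →₀ ℕ} (hγ : γ ∈ B) :
    hL.monomialSum e B = hL.mul (monomial γ 1) e + hL.monomialSum e (B.erase γ) := by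
  rw [monomialSum_eq, monomialSum_eq]
  exact (Finset.add_sum_erase B (fun β => hL.mul (monomial β 1) e) hγ).symm

theorem monomialSum_mem_weightSpan (hL : IsWittType P L) (he : (e : PolyDer σ) = eulerField a)
    {B : Finset (σ →₀ ℕ)} {A : Set ℝ} (h : ∀ β ∈ B, Finsupp.weight a β ∈ A) :
    hL.monomialSum e B ∈ weightSpan e A := by
  rw [monomialSum_eq]
  exact Submodule.sum_mem _ fun β hβ =>
    realWeightSpace_le_weightSpan e (h β hβ) (hL.monomial_mul_mem_realWeightSpace he β 1)

theorem lie_mul_monomialSum (hL : IsWittType P L) (he : (e : PolyDer σ) = eulerField a)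
    {p : MvPolynomial σ ℂ} (hp : eulerField a p = 0) (B : Finset (σ →₀ ℕ)) :
    ⁅hL.mul p (hL.monomialSum e B), hL.monomialSum e B⁆ = 0 := by
  have : hL.mul p (hL.monomialSum e B) = hL.mul (p * ∑ β ∈ B, monomial β 1) e :=
    Subtype.ext (smul_smul _ _ _)
  rw [this, monomialSum, hL.lie_mul_mul he, Derivation.leibniz, hp]
  simp only [smul_eq_mul]
  rw [← hL.zero_mul e]
  congr 1
  ring

/-- The leading term of `v` when `[v, ∑_{β ∈ B} t^β E]` has no weight above those of `B`. -/
theorem exists_top_eq_mul [DecidableEq σ] (hL : IsWittType P L) (ha : IsGenericWeight S a)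
    (he : (e : PolyDer σ) = eulerField a) {B : Finset (σ →₀ ℕ)} {γ : σ →₀ ℕ} (hγ : γ ∈ B)
    (hγS : γ.support ⊆ S) (hγ0 : γ ≠ 0)
    (hmax : ∀ β ∈ B.erase γ, Finsupp.weight a β < Finsupp.weight a γ)
    {A : Set ℝ} (hA : A ⊆ Set.Ioi 0) {v : L} (hv : v ∈ weightSpan e A) (hv0 : v ≠ 0)
    (hvz : ⁅v, hL.monomialSum e B⁆ ∈ weightSpan e (Set.Iic (Finsupp.weight a γ))) :
    Finsupp.weight a γ ∈ A ∧ ∃ p : MvPolynomial σ ℂ, eulerField a p = 0 ∧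
      v - hL.mul p (hL.mul (monomial γ 1) e) ∈
        weightSpan e (A ∩ Set.Iio (Finsupp.weight a γ)) := by
  set M := Finsupp.weight a γ
  obtain ⟨r, hr, v₀, hv₀, hv₀0, v', hv', rfl⟩ := exists_top_weight hv hv0
  have hr0 : 0 < r := hA hr
  have hz := hL.monomialSum_eq_add_erase (e := e) hγ
  have hzγ := hL.monomial_mul_mem_realWeightSpace he γ 1
  have hz' : hL.monomialSum e (B.erase γ) ∈ weightSpan e (Set.Iio M) :=
    hL.monomialSum_mem_weightSpan he hmax
  -- This bracket is the component of weight `r + M` in `[v, z]`, and `r + M > M` exceeds every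
  -- weight allowed there.
  have hcomm : ⁅v₀, hL.mul (monomial γ 1) e⁆ = 0 := by
    refine eq_zero_of_mem_weightSpan (e := e) (A := {r + M}) (B := Set.Iio (r + M)) (by simp) ?_ ?_
    · exact lie_mem_weightSpan (realWeightSpace_le_weightSpan e (Set.mem_singleton _) hv₀)
        (realWeightSpace_le_weightSpan e (Set.mem_singleton _) hzγ) (by simp [M])
    · have : ⁅v₀, hL.mul (monomial γ 1) e⁆ = ⁅v₀ + v', hL.monomialSum e B⁆ -
          ⁅v₀, hL.monomialSum e (B.erase γ)⁆ - ⁅v', hL.monomialSum e B⁆ := by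
        rw [add_lie, hz, lie_add, lie_add]; abel
      rw [this]
      refine Submodule.sub_mem _ (Submodule.sub_mem _ ?_ ?_) ?_
      · exact weightSpan_mono e (Set.Iic_subset_Iio.2 (by linarith)) hvz
      · refine lie_mem_weightSpan (realWeightSpace_le_weightSpan e (Set.mem_singleton _) hv₀) hz' ?_
        rintro _ rfl b hb
        simp only [Set.mem_Iio] at hb ⊢
        linarith
      · refine lie_mem_weightSpan hv' (hL.monomialSum_mem_weightSpan he (A := Set.Iic M) ?_) ?_
        · intro β hβ
          by_cases h : β = γ
          · rw [h]; exact le_refl M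
          · exact (hmax β (Finset.mem_erase.2 ⟨h, hβ⟩)).le
        · rintro b ⟨-, hb⟩ d hd
          simp only [Set.mem_Iio, Set.mem_Iic] at hb hd ⊢
          linarith
  obtain h | ⟨hrM, p, hp, hpv⟩ :=
    hL.eq_mul_of_lie_eq_zero ha he hγS hγ0 hr0.ne' hv₀ hcomm
  · exact absurd h hv₀0
  · change r = M at hrM
    subst hrM
    refine ⟨hr, p, hp, ?_⟩
    rw [← hpv, add_sub_cancel_left]
    exact hv'

/-- A lowest component of negative weight would have to commute with the lowest term `t^γ E`, its
bracket falling below the weights allowed. But a nonzero commuting field of nonzero weight has the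
weight of `γ`, which is positive. -/
theorem mem_weightSpan_pos_of_lie_mem [DecidableEq σ] (hL : IsWittType P L) (ha : IsGenericWeight S a)
    (he : (e : PolyDer σ) = eulerField a) {B : Finset (σ →₀ ℕ)} {γ : σ →₀ ℕ} (hγ : γ ∈ B)
    (hγS : γ.support ⊆ S) (hγ0 : γ ≠ 0)
    (hmin : ∀ β ∈ B.erase γ, Finsupp.weight a γ < Finsupp.weight a β)
    {v : L} (hv : v ∈ weightSpan e {0}ᶜ)
    (hvz : ⁅v, hL.monomialSum e B⁆ ∈ weightSpan e (Set.Ici (Finsupp.weight a γ))) :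
    v ∈ weightSpan e (Set.Ioi 0) := by
  set M := Finsupp.weight a γ
  have hM : 0 < M := ha.weight_pos hγS hγ0
  by_cases hv0 : v = 0
  · rw [hv0]; exact zero_mem _
  obtain ⟨r, hr, v₀, hv₀, hv₀0, v', hv', rfl⟩ := exists_bot_weight hv hv0
  rcases lt_or_gt_of_ne (show r ≠ 0 from hr) with hr0 | hr0
  · exfalso
    have hz := hL.monomialSum_eq_add_erase (e := e) hγ
    have hzγ := hL.monomial_mul_mem_realWeightSpace he γ 1
    have hz' : hL.monomialSum e (B.erase γ) ∈ weightSpan e (Set.Ioi M) :=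
      hL.monomialSum_mem_weightSpan he hmin
    have hcomm : ⁅v₀, hL.mul (monomial γ 1) e⁆ = 0 := by
      refine eq_zero_of_mem_weightSpan (e := e) (A := {r + M}) (B := Set.Ioi (r + M)) (by simp)
        ?_ ?_
      · exact lie_mem_weightSpan (realWeightSpace_le_weightSpan e (Set.mem_singleton _) hv₀)
          (realWeightSpace_le_weightSpan e (Set.mem_singleton _) hzγ) (by simp [M])
      · have : ⁅v₀, hL.mul (monomial γ 1) e⁆ = ⁅v₀ + v', hL.monomialSum e B⁆ -
            ⁅v₀, hL.monomialSum e (B.erase γ)⁆ - ⁅v', hL.monomialSum e B⁆ := by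
          rw [add_lie, hz, lie_add, lie_add]; abel
        rw [this]
        refine Submodule.sub_mem _ (Submodule.sub_mem _ ?_ ?_) ?_
        · exact weightSpan_mono e (Set.Ici_subset_Ioi.2 (by linarith)) hvz
        · refine lie_mem_weightSpan
            (realWeightSpace_le_weightSpan e (Set.mem_singleton _) hv₀) hz' ?_
          rintro _ rfl b hb
          simp only [Set.mem_Ioi] at hb ⊢
          linarith
        · refine lie_mem_weightSpan hv' (hL.monomialSum_mem_weightSpan he (A := Set.Ici M) ?_) ?_
          · intro β hβ
            by_cases h : β = γ
            · rw [h]; exact le_refl M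
            · exact (hmin β (Finset.mem_erase.2 ⟨h, hβ⟩)).le
          · rintro b ⟨-, hb⟩ d hd
            simp only [Set.mem_Ioi, Set.mem_Ici] at hb hd ⊢
            linarith
    obtain h | ⟨hrM, -⟩ := hL.eq_mul_of_lie_eq_zero ha he hγS hγ0 hr0.ne hv₀ hcomm
    · exact hv₀0 h
    · change r = M at hrM
      linarith
  · exact Submodule.add_mem _ (realWeightSpace_le_weightSpan e hr0 hv₀)
      (weightSpan_mono e (fun b hb => lt_trans hr0 hb.2) hv')

/-- The derivations of `L` that kill `∑_{β ∈ B} t^β E`. -/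
theorem exists_of_apply_monomialSum_eq_zero (hL : IsWittType P L) (ha : IsGenericWeight S a)
    (he : (e : PolyDer σ) = eulerField a) {B : Finset (σ →₀ ℕ)} (hne : B.Nonempty)
    (hB : ∀ β ∈ B, β.support ⊆ S ∧ β ≠ 0) {D : LieDerivation ℂ L L}
    (hD : D (hL.monomialSum e B) = 0) :
    ∃ p : MvPolynomial σ ℂ, eulerField a p = 0 ∧ ∃ D' : LieDerivation ℂ L L, D' e = 0 ∧
      (∀ β ∈ B, D' (hL.mul (monomial β 1) e) = 0) ∧
      ∀ y, D y = ⁅hL.mul p (hL.monomialSum e B), y⁆ + D' y := by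
  classical
  have hinj : Set.InjOn (Finsupp.weight a) (B : Set (σ →₀ ℕ)) := fun β hβ γ hγ h =>
    ha.eq_of_weight_eq (hB β hβ).1 (hB γ hγ).1 h
  obtain ⟨γ, hγ, hγmax⟩ := B.exists_max_image (Finsupp.weight a) hne
  obtain ⟨δ, hδ, hδmin⟩ := B.exists_min_image (Finsupp.weight a) hne
  have hmax : ∀ β ∈ B.erase γ, Finsupp.weight a β < Finsupp.weight a γ := fun β hβ =>
    lt_of_le_of_ne (hγmax β (Finset.mem_of_mem_erase hβ)) fun h =>
      Finset.ne_of_mem_erase hβ (hinj (Finset.mem_of_mem_erase hβ) hγ h)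
  have hmin : ∀ β ∈ B.erase δ, Finsupp.weight a δ < Finsupp.weight a β := fun β hβ =>
    lt_of_le_of_ne (hδmin β (Finset.mem_of_mem_erase hβ)) fun h =>
      Finset.ne_of_mem_erase hβ (hinj (Finset.mem_of_mem_erase hβ) hδ h.symm)
  obtain ⟨u, hu, hue⟩ := exists_lieDerivation_sub_ad_apply_eq_zero (hL.weightSpan_univ he)
    (fun x hx => hL.eq_zero_of_lie_eq_zero hx) D
  obtain ⟨D', hD'⟩ : ∃ D', D' = D - LieDerivation.ad ℂ L u := ⟨_, rfl⟩
  rw [← hD'] at hue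
  have hDy : ∀ y, D y = ⁅u, y⁆ + D' y := by
    intro y
    rw [hD', LieDerivation.sub_apply, LieDerivation.ad_apply_apply]
    abel
  have huz : ⁅u, hL.monomialSum e B⁆ = -D' (hL.monomialSum e B) := by
    rw [eq_neg_iff_add_eq_zero, ← hDy, hD]
  have hmem : ∀ A : Set ℝ, (∀ β ∈ B, Finsupp.weight a β ∈ A) →
      ⁅u, hL.monomialSum e B⁆ ∈ weightSpan e A := fun A hA => by
    rw [huz]
    exact Submodule.neg_mem _ (D'.mem_weightSpan hue (hL.monomialSum_mem_weightSpan he hA))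
  have hpos := hL.mem_weightSpan_pos_of_lie_mem ha he hδ (hB δ hδ).1 (hB δ hδ).2 hmin hu
    (hmem _ hδmin)
  obtain ⟨p, hp, hpu⟩ : ∃ p : MvPolynomial σ ℂ, eulerField a p = 0 ∧
      u = hL.mul p (hL.monomialSum e B) := by
    by_cases hu0 : u = 0
    · exact ⟨0, map_zero _, by rw [hu0, zero_mul]⟩
    obtain ⟨-, p, hp, hup⟩ := hL.exists_top_eq_mul ha he hγ (hB γ hγ).1 (hB γ hγ).2 hmax
      subset_rfl hpos hu0 (hmem _ hγmax)
    refine ⟨p, hp, ?_⟩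
    -- The difference `u - p z` has only weights below that of `γ` and the same bracket with `z` as
    -- `u`. If nonzero, the top-term argument would again force the weight of `γ` to occur in it.
    by_contra hne'
    have hz := hL.monomialSum_eq_add_erase (e := e) hγ
    have hlow : u - hL.mul p (hL.monomialSum e B) ∈
        weightSpan e (Set.Ioi 0 ∩ Set.Iio (Finsupp.weight a γ)) := by
      rw [hz, mul_add, ← sub_sub]
      refine Submodule.sub_mem _ hup (hL.mul_mem_weightSpan he hp
        (hL.monomialSum_mem_weightSpan he fun β hβ => ⟨?_, hmax β hβ⟩))
      exact ha.weight_pos (hB β (Finset.mem_of_mem_erase hβ)).1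
        (hB β (Finset.mem_of_mem_erase hβ)).2
    have := (hL.exists_top_eq_mul ha he hγ (hB γ hγ).1 (hB γ hγ).2 hmax
      Set.inter_subset_left hlow (sub_ne_zero.2 hne')
      (by rw [sub_lie, hL.lie_mul_monomialSum he hp, sub_zero]; exact hmem _ hγmax)).1
    exact lt_irrefl (Finsupp.weight a γ) this.2
  refine ⟨p, hp, D', hue, fun β hβ => ?_, fun y => by rw [← hpu, hDy]⟩
  refine eq_zero_of_sum_eq_zero (e := e) (s := B) (μ := Finsupp.weight a) hinj
    (x := fun β => D' (hL.mul (monomial β 1) e))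
    (fun β _ => D'.mem_realWeightSpace hue (hL.monomial_mul_mem_realWeightSpace he β 1)) ?_ hβ
  rw [← map_sum, ← monomialSum_eq, ← neg_eq_zero, ← huz, hpu, hL.lie_mul_monomialSum he hp]

/-- The part of `D` that preserves weights kills `t_i E` and `t_i² E`, hence all `t^δ E` over `S`,
hence the local part. Only `ad (p z)` survives, and `p` comes out of the bracket since local fields
kill it. -/
theorem exists_apply_eq_mul_lie (hL : IsWittType P L) (ha : IsGenericWeight S a)
    (he : (e : PolyDer σ) = eulerField a) (hS : S.Nonempty) {B : Finset (σ →₀ ℕ)}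
    (hB : ∀ β ∈ B, β.support ⊆ S ∧ β ≠ 0)
    (hB1 : ∀ i ∈ S, Finsupp.single i 1 ∈ B) (hB2 : ∀ i ∈ S, Finsupp.single i 2 ∈ B)
    {D : LieDerivation ℂ L L} (hD : D (hL.monomialSum e B) = 0) :
    ∃ p : MvPolynomial σ ℂ, eulerField a p = 0 ∧
      ∀ y : L, (y : PolyDer σ) ∈ localPart P S → D y = hL.mul p ⁅hL.monomialSum e B, y⁆ := by
  obtain ⟨i, hi⟩ := hS
  obtain ⟨p, hp, D', hD', hkill, h⟩ :=
    hL.exists_of_apply_monomialSum_eq_zero ha he ⟨_, hB1 i hi⟩ hB hD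
  refine ⟨p, hp, fun y hy => ?_⟩
  rw [h, hL.derivation_eq_zero_of_mem_localPart ha he hD' ?_ hy, add_zero,
    hL.lie_mul_right_of_mem_localPart ha hp _ hy]
  exact hL.derivation_monomial_mul_eq_zero ha he hD' (fun i hi => hkill _ (hB1 i hi))
    fun i hi => hkill _ (hB2 i hi)

end IsWittType

/-! ### 2-local derivations on the fields in finitely many variables. -/

namespace IsWittType

variable {σ : Type} {P : Set ((σ →₀ ℕ) × σ)} {L : LieSubalgebra ℂ (PolyDer σ)}
variable {S : Finset σ} {a : σ → ℝ} {e : L}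

/-- The exponents of the monomials `t_i` and `t_i ^ 2`, `i ∈ S`. -/
noncomputable def baseExponents [DecidableEq σ] (S : Finset σ) : Finset (σ →₀ ℕ) :=
  S.image (fun i => Finsupp.single i 1) ∪ S.image (fun i => Finsupp.single i 2)

theorem support_subset_of_mem_baseExponents [DecidableEq σ] {β : σ →₀ ℕ}
    (h : β ∈ baseExponents S) : β.support ⊆ S ∧ β ≠ 0 := by
  simp only [baseExponents, Finset.mem_union, Finset.mem_image] at h
  rcases h with ⟨i, hi, rfl⟩ | ⟨i, hi, rfl⟩ <;>
  exact ⟨Finsupp.support_single_subset.trans (by simpa using hi), by simp⟩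

theorem apply_eq_zero_of_isTwoLocalDerivation [DecidableEq σ] (hL : IsWittType P L)
    (ha : IsGenericWeight S a) (he : (e : PolyDer σ) = eulerField a) (hS : S.Nonempty)
    {Δ : L → L} (hΔ : IsTwoLocalDerivation ℂ Δ) (hΔe : Δ e = 0)
    (hΔx : Δ (hL.monomialSum e (baseExponents S)) = 0) {y : L}
    (hy : (y : PolyDer σ) ∈ localPart P S) : Δ y = 0 := by
  set B := baseExponents S with hBdef
  have hB : ∀ β ∈ B, β.support ⊆ S ∧ β ≠ 0 := fun β h => support_subset_of_mem_baseExponents h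
  have hB1 : ∀ i ∈ S, Finsupp.single i 1 ∈ B := fun i hi =>
    Finset.mem_union_left _ (Finset.mem_image_of_mem _ hi)
  have hB2 : ∀ i ∈ S, Finsupp.single i 2 ∈ B := fun i hi =>
    Finset.mem_union_right _ (Finset.mem_image_of_mem _ hi)
  set x := hL.monomialSum e B with hx
  obtain ⟨K, hK⟩ : ∃ K : ℝ, ∀ β ∈ B, Finsupp.weight a β ≤ K := by
    obtain ⟨K, hK⟩ := (B.finite_toSet.image (Finsupp.weight a)).bddAbove
    exact ⟨K, fun β hβ => hK ⟨β, hβ, rfl⟩⟩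
  have hxK : x ∈ weightSpan e (Set.Ioc 0 K) := hL.monomialSum_mem_weightSpan he fun β hβ =>
    ⟨ha.weight_pos (hB β hβ).1 (hB β hβ).2, hK β hβ⟩
  -- `Δ` stabilizes every sum of weight spaces
  have hΔw : ∀ (A : Set ℝ) (w : L), w ∈ weightSpan e A → Δ w ∈ weightSpan e A := by
    intro A w hw
    obtain ⟨D, hDe, hDw⟩ := hΔ e w
    rw [hDw]
    exact D.mem_weightSpan (hDe.symm.trans hΔe) hw
  obtain ⟨ω, hωS, hω0⟩ : ∃ ω : σ →₀ ℕ, ω.support ⊆ S ∧ ω ≠ 0 := by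
    obtain ⟨i, hi⟩ := hS
    exact ⟨_, hB _ (hB1 i hi)⟩
  have hs : 0 < Finsupp.weight a ω := ha.weight_pos hωS hω0
  set s := Finsupp.weight a ω with hsdef
  set m : MvPolynomial σ ℂ := monomial ω 1 with hm
  have hws : ∀ N : ℕ, Finsupp.weight a (N • ω) = N * s := fun N => by
    rw [map_nsmul, nsmul_eq_mul]
  have hsup : ∀ N : ℕ, (N • ω).support ⊆ S := fun N =>
    Finsupp.support_smul.trans hωS
  have hpow : ∀ N : ℕ, monomial (N • ω) (1 : ℂ) = m ^ N := fun N => by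
    rw [hm, monomial_pow, one_pow]
  have hzw : ∀ N : ℕ, hL.mul (m ^ N) e ∈ realWeightSpace e (N * s) := fun N => by
    rw [← hpow, ← hws]
    exact hL.monomial_mul_mem_realWeightSpace he _ _
  have hzloc : ∀ N : ℕ, (hL.mul (m ^ N) e : PolyDer σ) ∈ localPart P S := fun N => by
    rw [← hpow]
    exact hL.mul_eulerField_mem_localPart ha he (hsup N) 1
  have hxloc : (x : PolyDer σ) ∈ localPart P S := by
    rw [hx, monomialSum_eq, AddSubmonoidClass.coe_finsetSum]
    exact Submodule.sum_mem _ fun β hβ => hL.mul_eulerField_mem_localPart ha he (hB β hβ).1 1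
  -- `Δ` kills `x + m ^ N E` for large `N`
  have hΔz : ∀ N : ℕ, K < N * s → Δ (x + hL.mul (m ^ N) e) = 0 := by
    intro N hN
    obtain ⟨D, hDx, hDz⟩ := hΔ x (x + hL.mul (m ^ N) e)
    obtain ⟨p, hp, hpy⟩ := hL.exists_apply_eq_mul_lie ha he hS hB hB1 hB2 (hDx.symm.trans hΔx)
    have h1 : Δ (x + hL.mul (m ^ N) e) = hL.mul p ⁅x, hL.mul (m ^ N) e⁆ := by
      rw [hDz, hpy _ (Submodule.add_mem _ hxloc (hzloc N)), lie_add, lie_self, zero_add]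
    -- The argument has weights at most `N s`, and `Δ` preserves this; but `p [x, m^N E]` has only
    -- weights above `N s`, those of `x` being positive.
    refine eq_zero_of_mem_weightSpan (e := e) (A := Set.Iic (N * s)) (B := Set.Ioi (N * s))
      (Set.Iic_disjoint_Ioi le_rfl) (hΔw _ _ (Submodule.add_mem _ ?_ ?_)) ?_
    · exact weightSpan_mono e (fun r hr => Set.mem_Iic.2 (le_trans hr.2 hN.le)) hxK
    · exact realWeightSpace_le_weightSpan e (Set.mem_Iic.2 le_rfl) (hzw N)
    · rw [h1]
      refine hL.mul_mem_weightSpan he hp (lie_mem_weightSpan hxK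
        (realWeightSpace_le_weightSpan e (Set.mem_singleton _) (hzw N)) ?_)
      rintro r hr _ rfl
      exact lt_add_of_pos_left _ hr.1
  have hΔy : ∀ N : ℕ, K < N * s → ∃ p : MvPolynomial σ ℂ, eulerField a p = 0 ∧
      Δ y = hL.mul p (⁅x, y⁆ + ⁅hL.mul (m ^ N) e, y⁆) := by
    intro N hN
    obtain ⟨D, hDz, hDy⟩ := hΔ (x + hL.mul (m ^ N) e) y
    have hnot : N • ω ∉ B := fun h => by
      have := hK _ h
      rw [hws] at this
      linarith
    have hN0 : N • ω ≠ 0 := fun h => by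
      have h2 := hws N
      rw [h, map_zero] at h2
      obtain ⟨i, hi⟩ := hS
      have := ha.weight_pos (hB _ (hB1 i hi)).1 (hB _ (hB1 i hi)).2
      linarith [hK _ (hB1 i hi)]
    have hxz : x + hL.mul (m ^ N) e = hL.monomialSum e (insert (N • ω) B) := by
      rw [monomialSum_eq, Finset.sum_insert hnot, ← monomialSum_eq, hpow, add_comm]
    have hz0 : D (hL.monomialSum e (insert (N • ω) B)) = 0 := by
      rw [← hxz, ← hDz, hΔz N hN]
    obtain ⟨p, hp, hpy⟩ := hL.exists_apply_eq_mul_lie ha he hS (B := insert (N • ω) B)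
      (fun β hβ => (Finset.mem_insert.1 hβ).elim (fun h => h ▸ ⟨hsup N, hN0⟩) (hB β))
      (fun i hi => Finset.mem_insert_of_mem (hB1 i hi))
      (fun i hi => Finset.mem_insert_of_mem (hB2 i hi)) hz0
    exact ⟨p, hp, by rw [hDy, hpy y hy, ← hxz, add_lie]⟩
  obtain ⟨c, hc⟩ := exists_bound_weightSpan
    (show y ∈ weightSpan e Set.univ by rw [hL.weightSpan_univ he]; exact Submodule.mem_top)
  -- With the weights of `y` in `[-c, c]`, both `Δ y` and `p [x, y]` have weights at most `c + K`,
  -- and `p [m^N E, y]` at least `N s - c`. The second bound on `N` separates the two ranges.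
  have hcases : ∀ N : ℕ, K < N * s → 2 * c + K < N * s →
      Δ y = 0 ∨ ⁅hL.mul (m ^ N) e, y⁆ = 0 := by
    intro N hN hN'
    obtain ⟨p, hp, hpy⟩ := hΔy N hN
    have h0 : hL.mul p ⁅hL.mul (m ^ N) e, y⁆ = 0 := by
      refine eq_zero_of_mem_weightSpan (e := e) (A := Set.Iic (c + K) ∪ Set.Iic c)
        (B := Set.Ici (N * s - c)) ?_ ?_ ?_
      · rw [Set.disjoint_left]
        intro r hr hr'
        have h1 : N * s - c ≤ r := hr'
        rcases hr with hr | hr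
        · have h2 : r ≤ c + K := hr
          linarith
        · have h2 : r ≤ c := hr
          obtain ⟨i, hi⟩ := hS
          have := ha.weight_pos (hB _ (hB1 i hi)).1 (hB _ (hB1 i hi)).2
          linarith [hK _ (hB1 i hi)]
      · have : hL.mul p ⁅hL.mul (m ^ N) e, y⁆ = Δ y - hL.mul p ⁅x, y⁆ := by
          rw [hpy, mul_add]; abel
        rw [this]
        refine Submodule.sub_mem _ ?_ ?_
        · exact weightSpan_mono e (fun r hr => Or.inr hr.2) (hΔw _ _ hc)
        · refine hL.mul_mem_weightSpan he hp (lie_mem_weightSpan hxK hc ?_)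
          intro r hr t ht
          left
          have h1 := hr.2
          have h2 := ht.2
          rw [Set.mem_Iic]
          linarith
      · refine hL.mul_mem_weightSpan he hp (lie_mem_weightSpan
          (realWeightSpace_le_weightSpan e (Set.mem_singleton _) (hzw N)) hc ?_)
        rintro _ rfl t ht
        have h2 := ht.1
        rw [Set.mem_Ici]
        linarith
    rcases smul_derivation_eq_zero (congrArg Subtype.val h0 : _ = (0 : PolyDer σ)) with h | h
    · left; rw [hpy, h, zero_mul]
    · exact Or.inr (Subtype.ext h)
  obtain ⟨k, hk⟩ := exists_nat_gt ((|K| + |2 * c + K|) / s)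
  rw [div_lt_iff₀ hs] at hk
  have hkN : ∀ N : ℕ, k ≤ N → K < N * s ∧ 2 * c + K < N * s := by
    intro N hN
    have h1 : (k : ℝ) * s ≤ N * s := mul_le_mul_of_nonneg_right (by exact_mod_cast hN) hs.le
    constructor <;>
    linarith [le_abs_self K, le_abs_self (2 * c + K), abs_nonneg K, abs_nonneg (2 * c + K)]
  by_contra hne
  have hlie : ∀ N : ℕ, k ≤ N → ⁅hL.mul (m ^ N) e, y⁆ = 0 := fun N hN =>
    (hcases N (hkN N hN).1 (hkN N hN).2).resolve_left hne
  have hm0 : m ≠ 0 := by simp [hm]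
  -- From `[m^(N+1) E, y] = 0` a factor `m^N` cancels. The left side does not depend on `N`, so
  -- comparing two consecutive values gives `y(m) E = 0` and then `[E, y] = 0`.
  have hrel : ∀ N : ℕ, k ≤ N → m • ⁅eulerField a, (y : PolyDer σ)⁆ =
      ((N + 1 : ℕ) : MvPolynomial σ ℂ) • (y : PolyDer σ) m • eulerField a := by
    intro N hN
    have h := congrArg Subtype.val (hlie (N + 1) (by omega))
    rw [LieSubalgebra.coe_bracket, coe_mul, he, lie_smul_eq, Derivation.leibniz_pow,
      Nat.add_sub_cancel] at h
    have h' : m ^ N • (m • ⁅eulerField a, (y : PolyDer σ)⁆ -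
        ((N + 1 : ℕ) : MvPolynomial σ ℂ) • (y : PolyDer σ) m • eulerField a) = 0 := by
      rw [← show _ = (0 : PolyDer σ) from h, smul_sub, smul_smul, ← pow_succ, smul_smul, smul_smul,
        nsmul_eq_mul, smul_eq_mul]
      congr 2
      ring
    exact sub_eq_zero.1 ((smul_derivation_eq_zero h').resolve_left (pow_ne_zero _ hm0))
  have hE0 : (y : PolyDer σ) m • eulerField a = 0 := by
    have h1 := hrel k le_rfl
    have h2 := hrel (k + 1) (Nat.le_succ k)
    rw [h1] at h2
    rw [Nat.cast_succ (k + 1), add_smul, one_smul, left_eq_add] at h2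
    exact h2
  have hEy : ⁅eulerField a, (y : PolyDer σ)⁆ = 0 := by
    have h1 := hrel k le_rfl
    rw [hE0, smul_zero] at h1
    exact (smul_derivation_eq_zero h1).resolve_left hm0
  have hy0 : y ∈ weightSpan e {0} := realWeightSpace_le_weightSpan e (Set.mem_singleton _)
    ((mem_realWeightSpace_iff he).2 (by rw [hEy]; simp))
  obtain ⟨p, hp, hpy⟩ := hΔy k (hkN k le_rfl).1
  rw [hlie k le_rfl, add_zero] at hpy
  refine hne (eq_zero_of_mem_weightSpan (e := e) (A := {0}) (B := Set.Ioi 0) (by simp)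
    (hΔw _ _ hy0) ?_)
  rw [hpy]
  refine hL.mul_mem_weightSpan he hp (lie_mem_weightSpan hxK hy0 ?_)
  rintro r hr _ rfl
  rw [add_zero]
  exact hr.1

/-- The two test elements `E` and `x` determine the derivation. Subtracting it from `Δ` leaves a
2-local derivation that vanishes at both. -/
theorem exists_eq_on_localPart [Countable σ] (hL : IsWittType P L) (hS : S.Nonempty)
    {Δ : L → L} (hΔ : IsTwoLocalDerivation ℂ Δ) :
    ∃ D : LieDerivation ℂ L L, ∀ y : L, (y : PolyDer σ) ∈ localPart P S → Δ y = D y := by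
  classical
  obtain ⟨a, ha⟩ := exists_isGenericWeight S
  set e : L := ⟨eulerField a, hL.eulerField_mem ha.eq_zero⟩ with he
  obtain ⟨D, hDe, hDx⟩ := hΔ e (hL.monomialSum e (baseExponents S))
  refine ⟨D, fun y hy => sub_eq_zero.1 ?_⟩
  refine hL.apply_eq_zero_of_isTwoLocalDerivation (e := e) (Δ := fun y => Δ y - D y) ha rfl hS ?_
    (sub_eq_zero.2 hDe) (sub_eq_zero.2 hDx) hy
  intro u v
  obtain ⟨D', hu, hv⟩ := hΔ u v
  exact ⟨D' - D, by simp [hu], by simp [hv]⟩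

/-- Every 2-local derivation of an algebra of Witt type is a derivation. -/
theorem isLieDerivationMap [Countable σ] [Nonempty σ] (hL : IsWittType P L) {Δ : L → L}
    (hΔ : IsTwoLocalDerivation ℂ Δ) : IsLieDerivationMap ℂ Δ := by
  classical
  -- The passage from two points to three, which additivity and the Leibniz rule require. An
  -- arbitrary extra variable keeps `S` nonempty.
  have key : ∀ x y z : L, ∃ D : LieDerivation ℂ L L, Δ x = D x ∧ Δ y = D y ∧ Δ z = D z := by
    intro x y z
    obtain ⟨S₁, h₁⟩ := hL.exists_mem_localPart x.2
    obtain ⟨S₂, h₂⟩ := hL.exists_mem_localPart y.2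
    obtain ⟨S₃, h₃⟩ := hL.exists_mem_localPart z.2
    obtain ⟨D, hD⟩ := hL.exists_eq_on_localPart
      (S := insert (Classical.arbitrary σ) (S₁ ∪ S₂ ∪ S₃)) (Finset.insert_nonempty _ _) hΔ
    refine ⟨D, hD x (localPart_mono P ?_ h₁), hD y (localPart_mono P ?_ h₂),
      hD z (localPart_mono P ?_ h₃)⟩ <;>
    · intro i hi
      simp [hi]
  have hadd : ∀ x y : L, Δ (x + y) = Δ x + Δ y := fun x y => by
    obtain ⟨D, h1, h2, h3⟩ := key x y (x + y)
    rw [h1, h2, h3, map_add]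
  have hsmul : ∀ (c : ℂ) (x : L), Δ (c • x) = c • Δ x := fun c x => by
    obtain ⟨D, h1, h2⟩ := hΔ x (c • x)
    rw [h1, h2, map_smul]
  have hlie : ∀ x y : L, Δ ⁅x, y⁆ = ⁅x, Δ y⁆ - ⁅y, Δ x⁆ := fun x y => by
    obtain ⟨D, h1, h2, h3⟩ := key x y ⁅x, y⁆
    rw [h1, h2, h3, D.apply_lie_eq_sub]
  exact ⟨{ toFun := Δ, map_add' := hadd, map_smul' := hsmul, leibniz' := hlie }, fun _ => rfl⟩

end IsWittType

/-! ### The concrete algebras and transport along isomorphisms. -/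

theorem isWittType_wittPlus (σ : Type) : IsWittType Set.univ (wittPlus σ) where
  toSubmodule_eq := by
    refine congrArg (Submodule.span ℂ) (Set.ext fun x => ?_)
    simp [eq_comm]
  mem_of_ne_zero _ _ _ := Set.mem_univ _
  add_mem _ _ _ _ := Set.mem_univ _

theorem eulerTerm_eq_partialTerm {σ : Type} (α : σ →₀ ℕ) (i : σ) :
    eulerTerm α i = partialTerm (α + Finsupp.single i 1) i := by
  rw [eulerTerm, partialTerm, smul_smul, X, monomial_mul, one_mul]

theorem isWittType_wittPlusPlus (σ : Type) :
    IsWittType {q : (σ →₀ ℕ) × σ | q.1 q.2 ≠ 0} (wittPlusPlus σ) where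
  toSubmodule_eq := by
    refine congrArg (Submodule.span ℂ) (Set.ext fun x => ⟨?_, ?_⟩)
    · rintro ⟨α, i, rfl⟩
      exact ⟨(α + Finsupp.single i 1, i), by simp, (eulerTerm_eq_partialTerm α i).symm⟩
    · rintro ⟨⟨α, i⟩, h, rfl⟩
      have hle : Finsupp.single i 1 ≤ α :=
        Finsupp.single_le_iff.2 (Nat.one_le_iff_ne_zero.2 h)
      exact ⟨α - Finsupp.single i 1, i, by rw [eulerTerm_eq_partialTerm, tsub_add_cancel_of_le hle]⟩
  mem_of_ne_zero _ _ h := h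
  add_mem α β i h := by
    simp only [Set.mem_ofPred_eq, Finsupp.add_apply] at h ⊢
    omega

/-- Transport of a derivation along an isomorphism of Lie algebras. -/
def LieDerivation.transport {L M : Type*} [LieRing L] [LieAlgebra ℂ L] [LieRing M]
    [LieAlgebra ℂ M] (φ : L ≃ₗ⁅ℂ⁆ M) (D : LieDerivation ℂ L L) : LieDerivation ℂ M M where
  toLinearMap := φ.toLinearEquiv.toLinearMap ∘ₗ D.toLinearMap ∘ₗ φ.symm.toLinearEquiv.toLinearMap
  leibniz' x y := by
    change φ (D (φ.symm ⁅x, y⁆)) = ⁅x, φ (D (φ.symm y))⁆ - ⁅y, φ (D (φ.symm x))⁆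
    rw [LieEquiv.map_lie, D.apply_lie_eq_sub, map_sub, LieEquiv.map_lie, LieEquiv.map_lie,
      φ.apply_symm_apply, φ.apply_symm_apply]

theorem LieDerivation.transport_apply {L M : Type*} [LieRing L] [LieAlgebra ℂ L] [LieRing M]
    [LieAlgebra ℂ M] (φ : L ≃ₗ⁅ℂ⁆ M) (D : LieDerivation ℂ L L) (x : M) :
    D.transport φ x = φ (D (φ.symm x)) := rfl

theorem isLieDerivationMap_of_lieEquiv {L M : Type*} [LieRing L] [LieAlgebra ℂ L] [LieRing M]
    [LieAlgebra ℂ M] (φ : L ≃ₗ⁅ℂ⁆ M)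
    (h : ∀ Δ : L → L, IsTwoLocalDerivation ℂ Δ → IsLieDerivationMap ℂ Δ) {Δ : M → M}
    (hΔ : IsTwoLocalDerivation ℂ Δ) : IsLieDerivationMap ℂ Δ := by
  obtain ⟨D, hD⟩ := h (fun x => φ.symm (Δ (φ x))) fun x y => by
    obtain ⟨D, hx, hy⟩ := hΔ (φ x) (φ y)
    exact ⟨D.transport φ.symm, congrArg φ.symm hx, congrArg φ.symm hy⟩
  refine ⟨D.transport φ, fun x => ?_⟩
  rw [LieDerivation.transport_apply, ← hD, φ.apply_symm_apply, φ.apply_symm_apply]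

theorem theorem5p1 :
    (∀ n : ℕ, 1 ≤ n →
      (∀ Δ : PolyDer (Fin n) → PolyDer (Fin n),
        IsTwoLocalDerivation ℂ Δ → IsLieDerivationMap ℂ Δ) ∧
      (∀ Δ : wittPlusPlus (Fin n) → wittPlusPlus (Fin n),
        IsTwoLocalDerivation ℂ Δ → IsLieDerivationMap ℂ Δ)) ∧
    (∀ Δ : wittPlus ℕ → wittPlus ℕ,
      IsTwoLocalDerivation ℂ Δ → IsLieDerivationMap ℂ Δ) ∧
    (∀ Δ : wittPlusPlus ℕ → wittPlusPlus ℕ,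
      IsTwoLocalDerivation ℂ Δ → IsLieDerivationMap ℂ Δ) := by
  refine ⟨fun n hn => ?_, fun Δ hΔ => (isWittType_wittPlus ℕ).isLieDerivationMap hΔ,
    fun Δ hΔ => (isWittType_wittPlusPlus ℕ).isLieDerivationMap hΔ⟩
  have : Nonempty (Fin n) := ⟨⟨0, hn⟩⟩
  refine ⟨fun Δ hΔ => ?_, fun Δ hΔ => (isWittType_wittPlusPlus (Fin n)).isLieDerivationMap hΔ⟩
  have htop : IsWittType Set.univ (⊤ : LieSubalgebra ℂ (PolyDer (Fin n))) :=
    wittPlus_eq_top (Fin n) ▸ isWittType_wittPlus (Fin n)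
  exact isLieDerivationMap_of_lieEquiv LieSubalgebra.topEquiv
    (fun Δ hΔ => htop.isLieDerivationMap hΔ) hΔ
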